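/- Let $d,m\ge 1$ and let $\eta(x)=(\eta_1(x),\dots,\eta_m(x))$, $x\in\mathbb{R}^d$, be a measurable zero-mean homogeneous isotropic Gaussian vector random field whose covariance matrix satisfies $\mathbf{E}\,\eta_i(x)\eta_j(y)=0$ for $i\ne j$, $\mathbf{E}\,\eta_j(x)^2=1$, and $\mathbf{E}\,\eta_j(x)\eta_j(y)=\|x-y\|^{-\alpha_j}L_j(\|x-y\|)$ for $x\neq y$, where $\alpha_j>0$ and each $L_j$ is slowly varying at infinity. Let $\Delta\subset\mathbb{R}^d$ be a bounded convex set containing the origin in its interior, and $\Delta(r)=r\Delta$. Let $\gamma_m$ be the standard Gaussian measure on $\mathbb{R}^m$ and $G\in L_2(\mathbb{R}^m,\gamma_m)$. For $v\in\mathbb{Z}_{\ge0}^m$ put $|v|=\sum_j v_j$, $v!=\prod_j v_j!$, $e_v(w)=\prod_j H_{v_j}(w_j)$ with $H_k$ the (probabilists') Hermite polynomials, and $C_v=\int G\,e_v\,d\gamma_m$. Suppose that $G$ has Hermite rank $\kappa\ge1$, i.e. $\kappa$ is the smallest integer $\ge 1$ such that $C_v\neq0$ for some $v$ with $|v|=\kappa$.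 Suppose that $$\sum_{j=1}^m\alpha_jv_j<(\kappa+1)\min_{1\le j\le m}\alpha_j\qquad\text{and}\qquad \sum_{j=1}^m\alpha_jv_j<d$$ for at least one $v$ with $|v|=\kappa$ and $C_v\ne0$ (in particular, this holds if both inequalities hold for all $v$ with $|v|=\kappa$). Put $$K_r=\int_{\Delta(r)}G(\eta(x))\,dx,\qquad K_{r,\kappa}=\sum_{|v|=\kappa}\frac{C_v}{v!}\int_{\Delta(r)}e_v(\eta(x))\,dx .$$ Then these integrals exist almost surely, $K_r$ and $K_{r,\kappa}$ have finite variances, which are positive for all large $r$, and $\mathbf{Var}(K_r-K_{r,\kappa})/\mathbf{Var}K_{r,\kappa}\to0$ as $r\to\infty$. Moreover, if a limit distribution as $r\to\infty$ exists for at least one of the random variables $$\frac{K_r-\mathbf{E}K_r}{\sqrt{\mathbf{Var}K_r}}\qquad\text{and}\qquad\frac{K_{r,\kappa}}{\sqrt{\mathbf{Var}K_{r,\kappa}}},$$ then the limit distribution of the other exists as well, and the two limit distributions coincide. -/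

import Mathlib

open MeasureTheory ProbabilityTheory Filter Topology
open scoped Pointwise

noncomputable section

/-- `L` is slowly varying at infinity: measurable, positive near infinity, and
`L (c t) / L t → 1` as `t → ∞`, for every `c > 0`. -/
def SlowlyVarying (L : ℝ → ℝ) : Prop :=
  Measurable L ∧ (∀ᶠ t in atTop, 0 < L t) ∧
    ∀ c : ℝ, 0 < c → Tendsto (fun t => L (c * t) / L t) atTop (𝓝 1)

/-- A measurable, centred Gaussian vector random field `η = (η₁, …, η_m)` on `ℝᵈ` with unit variance
and uncorrelated components, whose `j`-th component has the (homogeneous and isotropic) covariance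
function `‖x‖ ^ (-α_j) L_j(‖x‖)` for `x ≠ 0`, where `α_j > 0` and `L_j` is slowly varying at
infinity. -/
structure IsLongMemoryField {Ω : Type*} [MeasurableSpace Ω] {d m : ℕ} (P : Measure Ω)
    (η : EuclideanSpace ℝ (Fin d) → Ω → (Fin m → ℝ)) (α : Fin m → ℝ) (L : Fin m → ℝ → ℝ) :
    Prop where
  measurable_field : Measurable fun p : EuclideanSpace ℝ (Fin d) × Ω => η p.1 p.2
  gaussian : IsGaussianProcess η P
  mean_zero : ∀ x j, ∫ ω, η x ω j ∂P = 0
  exponent_pos : ∀ j, 0 < α j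
  slowlyVarying : ∀ j, SlowlyVarying (L j)
  cov_eq : ∀ x y i j, cov[fun ω => η x ω i, fun ω => η y ω j; P] =
    if i = j then (if x = y then 1 else ‖x - y‖ ^ (-α j) * L j ‖x - y‖) else 0

/-- The standard Gaussian measure `φ(‖w‖) dw` on `ℝᵐ`. -/
def stdGauss (m : ℕ) : Measure (Fin m → ℝ) := Measure.pi fun _ => gaussianReal 0 1

/-- `e_v(w) = ∏ⱼ H_{v_j}(w_j)`, with `H_k` the (probabilists') Hermite polynomials. -/
def hermiteProd {m : ℕ} (v : Fin m → ℕ) (w : Fin m → ℝ) : ℝ :=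
  ∏ j, Polynomial.aeval (w j) (Polynomial.hermite (v j))

/-- The Hermite coefficient `C_v = ∫ G(w) e_v(w) φ(‖w‖) dw`. -/
def hermiteCoeff {m : ℕ} (G : (Fin m → ℝ) → ℝ) (v : Fin m → ℕ) : ℝ :=
  ∫ w, G w * hermiteProd v w ∂(stdGauss m)

/-- `κ` is the Hermite rank of `G`: the smallest `κ ≥ 1` such that `C_v ≠ 0` for some multi-index
`v` of total degree `κ`. -/
def IsHermiteRank {m : ℕ} (G : (Fin m → ℝ) → ℝ) (κ : ℕ) : Prop :=
  1 ≤ κ ∧ (∀ v : Fin m → ℕ, 1 ≤ ∑ j, v j → ∑ j, v j < κ → hermiteCoeff G v = 0) ∧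
    ∃ v : Fin m → ℕ, ∑ j, v j = κ ∧ hermiteCoeff G v ≠ 0

/-- `K_r = ∫_{Δ(r)} G(η(x)) dx`, with `Δ(r) = r • Δ`. -/
def fieldIntegral {Ω : Type*} {d m : ℕ} (η : EuclideanSpace ℝ (Fin d) → Ω → (Fin m → ℝ))
    (Δ : Set (EuclideanSpace ℝ (Fin d))) (G : (Fin m → ℝ) → ℝ) (r : ℝ) (ω : Ω) : ℝ :=
  ∫ x in r • Δ, G (η x ω)

/-- `K_{r,κ} = ∑_{|v| = κ} C_v / v! ∫_{Δ(r)} e_v(η(x)) dx`. -/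
def hermiteProjIntegral {Ω : Type*} {d m : ℕ} (η : EuclideanSpace ℝ (Fin d) → Ω → (Fin m → ℝ))
    (Δ : Set (EuclideanSpace ℝ (Fin d))) (G : (Fin m → ℝ) → ℝ) (κ : ℕ) (r : ℝ) (ω : Ω) : ℝ :=
  ∑ v ∈ Finset.piAntidiag (Finset.univ : Finset (Fin m)) κ,
    hermiteCoeff G v / (∏ j, (v j).factorial : ℕ) * ∫ x in r • Δ, hermiteProd v (η x ω)

end

/-! Expand `G` in the Hermite products, a complete orthogonal system of `L²(γ_m)`. For two standard
Gaussian vectors whose only cross-correlations are `ρ_j` between components of equal index, Mehler's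
formula (`IsCorrelatedPair.hasSum_integral`) gives `E F(X) F(Y) = ∑_v C_v² / v! ∏_j ρ_j ^ v_j`. If
the coefficients of `F` of degree at most `κ` vanish, this is at most `(max_j |ρ_j|) ^ (κ + 1) ‖F‖²`
in modulus (`abs_integral_le`).

Let `β = ∑ α_j v_j` for the multi-index granted by the hypothesis, and choose `β < b₁ < b₂ < min((κ
+ 1) min α, d)`. Slowly varying functions lie between `t ^ (-ε)` and `t ^ ε`
(`SlowlyVarying.eventually_rpow_bounds`), so powers of the distance bound the correlations.
Integrating over pairs of points of `r • Δ`, the variance of the remainder `K_r - E K_r - K_{r,κ}`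
is `O(r ^ (2d - b₂))` (`exists_integral_sq_le`).

Conversely, different Hermite products are uncorrelated along the field, so `Var K_{r,κ}` is a sum
of nonnegative contributions, one for each multi-index of degree `κ` (`le_integral_sq_hermiteProj`).
The distinguished one alone is at least a constant times `r ^ (2d - b₁)`
(`exists_le_integral_sq_hermiteProd`); this is why a single good multi-index suffices.

The variance ratio is therefore `O(r ^ (-(b₂ - b₁)))`. Consequently the two normalized variables
differ by a quantity that tends to zero in `L²`, hence in probability
(`tendstoInMeasure_normalized_sub`), and Slutsky's theorem transfers limit laws both ways. -/

/-! ### Hermite polynomials and the Gaussian law on the line -/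

section OneDim

open Polynomial

theorem Polynomial.derivative_hermite_succ (n : ℕ) :
    derivative (hermite (n + 1)) = (n + 1 : ℤ[X]) * hermite n := by
  induction n with
  | zero => simp [hermite_succ]
  | succ n ih =>
    rw [hermite_succ, derivative_sub, derivative_mul, derivative_X, one_mul, ih, derivative_mul]
    have h : derivative ((n : ℤ[X]) + 1) = 0 := by simp
    rw [h, zero_mul, zero_add]
    have e := hermite_succ n
    push_cast
    linear_combination (-(n + 1 : ℤ[X])) * e

/-- The Hermite polynomials, with real coefficients. -/
noncomputable def realHermite (n : ℕ) : ℝ[X] := (hermite n).map (Int.castRingHom ℝ)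

theorem aeval_hermite (n : ℕ) (x : ℝ) : aeval x (hermite n) = (realHermite n).eval x := by
  rw [aeval_def, realHermite, eval_map, algebraMap_int_eq]

theorem realHermite_zero : realHermite 0 = 1 := by simp [realHermite]

theorem realHermite_succ (n : ℕ) :
    realHermite (n + 1) = X * realHermite n - derivative (realHermite n) := by
  simp [realHermite, hermite_succ, derivative_map]

theorem derivative_realHermite_succ (n : ℕ) :
    derivative (realHermite (n + 1)) = C (n + 1 : ℝ) * realHermite n := by
  rw [realHermite, derivative_map, derivative_hermite_succ]
  simp [realHermite]

theorem integrable_eval_gaussianReal (p : ℝ[X]) (μ : ℝ) (v : NNReal) :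
    Integrable (fun x => p.eval x) (gaussianReal μ v) := by
  simp_rw [eval_eq_sum_range]
  refine integrable_finsetSum _ fun i _ => Integrable.const_mul ?_ _
  have := (memLp_id_gaussianReal (μ := μ) (v := v) (i : NNReal)).integrable_norm_pow'
  rw [← integrable_norm_iff (by fun_prop)]
  simpa using this

theorem memLp_two_eval_gaussianReal (p : ℝ[X]) (μ : ℝ) (v : NNReal) :
    MemLp (fun x => p.eval x) 2 (gaussianReal μ v) := by
  rw [memLp_two_iff_integrable_sq (by fun_prop)]
  simp_rw [← eval_pow]
  exact integrable_eval_gaussianReal (p ^ 2) μ v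

theorem integrable_mul_eval_gaussianReal (p : ℝ[X]) (μ : ℝ) (v : NNReal) :
    Integrable (fun x => x * p.eval x) (gaussianReal μ v) := by
  exact (integrable_eval_gaussianReal (X * p) μ v).congr (ae_of_all _ fun x => by simp)

/-- Gaussian integration by parts for polynomials. -/
theorem integral_X_mul_eval_gaussianReal (p : ℝ[X]) (v : NNReal) :
    ∫ x, x * p.eval x ∂(gaussianReal 0 v) = v * ∫ x, (derivative p).eval x ∂(gaussianReal 0 v) := by
  by_cases hv : v = 0
  · simp [hv]
  have hv' : (v : ℝ) ≠ 0 := by exact_mod_cast hv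
  have hint : ∀ q : ℝ[X], Integrable (fun x => gaussianPDFReal 0 v x * q.eval x) := by
    intro q
    have := integrable_eval_gaussianReal q 0 v
    rw [gaussianReal_of_var_ne_zero _ hv, integrable_withDensity_iff_integrable_smul'
      (measurable_gaussianPDF 0 v) (by simp [gaussianPDF_lt_top])] at this
    simpa using this
  have hder : ∀ x, HasDerivAt (fun x => gaussianPDFReal 0 v x * p.eval x)
      (gaussianPDFReal 0 v x * ((derivative p) - C ((v : ℝ)⁻¹) * (X * p)).eval x) x := by
    intro x
    have h1 : HasDerivAt (gaussianPDFReal 0 v) (gaussianPDFReal 0 v x * (-(x / v))) x := by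
      unfold gaussianPDFReal
      have h0 : HasDerivAt (fun x : ℝ => -(x - 0) ^ 2 / (2 * v)) (-(x / v)) x := by
        have := ((((hasDerivAt_id x).sub_const 0).pow 2).neg).div_const (2 * (v : ℝ))
        refine this.congr_deriv ?_
        simp
        field_simp
      refine (h0.exp.const_mul _).congr_deriv ?_
      ring
    refine (h1.mul (p.hasDerivAt x)).congr_deriv ?_
    simp
    field_simp
    ring
  -- The derivative of density times polynomial is again density times polynomial, so both are
  -- integrable and the derivative has integral zero.
  have := integral_eq_zero_of_hasDerivAt_of_integrable hder (hint _) (hint _)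
  have h2 : ∫ x, (derivative p - C ((v : ℝ)⁻¹) * (X * p)).eval x ∂(gaussianReal 0 v) = 0 := by
    rw [integral_gaussianReal_eq_integral_smul hv]
    simpa using this
  simp only [eval_sub, eval_mul, eval_C, eval_X] at h2
  have hi := integrable_mul_eval_gaussianReal p 0 v
  rw [integral_sub (integrable_eval_gaussianReal _ _ _) (hi.const_mul _), integral_const_mul] at h2
  field_simp at h2
  linarith

/-- The operator `q ↦ X q - q'`, which raises the Hermite degree, is the adjoint of differentiation
under the Gaussian measure. Iterating gives orthogonality. -/
theorem integral_mul_realHermite_succ (p : ℝ[X]) (n : ℕ) :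
    ∫ x, p.eval x * (realHermite (n + 1)).eval x ∂(gaussianReal 0 1) =
      ∫ x, (derivative p).eval x * (realHermite n).eval x ∂(gaussianReal 0 1) := by
  have h := integral_X_mul_eval_gaussianReal (p * realHermite n) 1
  have e1 : ∀ x, p.eval x * (realHermite (n + 1)).eval x =
      x * (p * realHermite n).eval x - (p * derivative (realHermite n)).eval x := by
    intro x; rw [realHermite_succ]; simp; ring
  have e2 : ∀ x, (derivative p).eval x * (realHermite n).eval x =
      (derivative (p * realHermite n)).eval x - (p * derivative (realHermite n)).eval x := by
    intro x; simp
  simp_rw [e1, e2]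
  rw [integral_sub (integrable_mul_eval_gaussianReal _ _ _) (integrable_eval_gaussianReal _ _ _),
    integral_sub (integrable_eval_gaussianReal _ _ _) (integrable_eval_gaussianReal _ _ _), h]
  simp

theorem integral_realHermite_mul_realHermite (k l : ℕ) :
    ∫ x, (realHermite k).eval x * (realHermite l).eval x ∂(gaussianReal 0 1) =
      if k = l then (k.factorial : ℝ) else 0 := by
  induction k generalizing l with
  | zero =>
    cases l with
    | zero => simp [realHermite_zero]
    | succ l => rw [integral_mul_realHermite_succ]; simp [realHermite_zero]
  | succ k ih =>
    cases l with
    | zero =>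
      simp_rw [mul_comm _ (eval _ (realHermite 0))]
      rw [integral_mul_realHermite_succ]; simp [realHermite_zero]
    | succ l =>
      rw [integral_mul_realHermite_succ, derivative_realHermite_succ]
      simp only [eval_mul, eval_C, mul_assoc]
      rw [integral_const_mul, ih]
      simp [Nat.factorial_succ]

/-- The Ornstein–Uhlenbeck average of a Hermite polynomial. -/
theorem integral_realHermite_add (ρ x : ℝ) (v : NNReal) (hv : (v : ℝ) = 1 - ρ ^ 2) (n : ℕ) :
    ∫ w, (realHermite n).eval (ρ * x + w) ∂(gaussianReal 0 v) =
      ρ ^ n * (realHermite n).eval x := by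
  have hcomp : ∀ (p : ℝ[X]) (w : ℝ), p.eval (ρ * x + w) = (p.comp (X + C (ρ * x))).eval w := by
    intro p w; simp [add_comm]
  have hint : ∀ p : ℝ[X], Integrable (fun w => p.eval (ρ * x + w)) (gaussianReal 0 v) := by
    intro p; simp_rw [hcomp]; exact integrable_eval_gaussianReal _ _ _
  induction n using Nat.strong_induction_on with
  | _ n ih =>
  cases n with
  | zero => simp [realHermite_zero]
  | succ n =>
    -- Integrating the term `w * H_n` by parts produces `(1 - ρ²) H_n'`. Together with `-H_n'` this
    -- leaves `-ρ² H_n'`, which involves `H_{n-1}`; hence strong induction.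
    have e1 : ∀ w, (realHermite (n + 1)).eval (ρ * x + w) =
        ρ * x * (realHermite n).eval (ρ * x + w) +
          w * ((realHermite n).comp (X + C (ρ * x))).eval w -
          (derivative (realHermite n)).eval (ρ * x + w) := by
      intro w; rw [realHermite_succ, ← hcomp]; simp; ring
    simp_rw [e1]
    have hi := integrable_mul_eval_gaussianReal ((realHermite n).comp (X + C (ρ * x))) 0 v
    have hi' : Integrable (fun w => ρ * x * (realHermite n).eval (ρ * x + w) +
        w * ((realHermite n).comp (X + C (ρ * x))).eval w) (gaussianReal 0 v) :=
      ((hint _).const_mul _).add hi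
    rw [integral_sub hi' (hint _), integral_add
      ((hint _).const_mul _) hi, integral_const_mul, integral_X_mul_eval_gaussianReal,
      derivative_comp]
    have e2 : (derivative (X + C (ρ * x)) : ℝ[X]) = 1 := by simp
    rw [e2, one_mul]
    simp_rw [← hcomp]
    rw [ih n (Nat.lt_succ_self n), hv]
    cases n with
    | zero => simp [realHermite_zero, realHermite_succ]
    | succ n =>
      rw [realHermite_succ (n + 1), derivative_realHermite_succ]
      simp only [eval_mul, eval_C, eval_sub, eval_X]
      rw [integral_const_mul, ih n (by omega)]
      ring

end OneDim

/-! ### Hermite products of correlated Gaussian vectors -/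

section Pair

variable {Ω : Type*} [MeasurableSpace Ω] {P : Measure Ω}

/-- Write `V = ρ U + W` with `W` independent of `U` and of variance `1 - ρ²`. Averaging over `W`
turns `H_l(V)` into `ρ ^ l H_l(U)`, and orthogonality on the line finishes. -/
theorem integral_realHermite_pair {U V : Ω → ℝ} {ρ : ℝ}
    (h : HasGaussianLaw (fun ω => (U ω, V ω)) P) (hU : ∫ ω, U ω ∂P = 0) (hV : ∫ ω, V ω ∂P = 0)
    (hUU : cov[U, U; P] = 1) (hVV : cov[V, V; P] = 1) (hUV : cov[U, V; P] = ρ) (k l : ℕ) :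
    ∫ ω, (realHermite k).eval (U ω) * (realHermite l).eval (V ω) ∂P =
      if k = l then k.factorial * ρ ^ k else 0 := by
  have : IsProbabilityMeasure P := h.isProbabilityMeasure
  have hUm := h.fst.aemeasurable
  have hVm := h.snd.aemeasurable
  have hU2 := h.fst.memLp_two
  have hV2 := h.snd.memLp_two
  set W : Ω → ℝ := fun ω => V ω - ρ * U ω with hW
  have hUW : HasGaussianLaw (fun ω => (U ω, W ω)) P :=
    h.map_fun ((ContinuousLinearMap.fst ℝ ℝ ℝ).prod
      (ContinuousLinearMap.snd ℝ ℝ ℝ - ρ • ContinuousLinearMap.fst ℝ ℝ ℝ))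
  have hWm := hUW.snd.aemeasurable
  have hρU2 : MemLp (fun ω => ρ * U ω) 2 P := hU2.const_mul ρ
  have hcUW : cov[U, W; P] = 0 := by
    rw [hW, covariance_fun_sub_right hU2 hV2 hρU2, covariance_const_mul_right, hUU, hUV]
    ring
  have hvar : Var[W; P] = 1 - ρ ^ 2 := by
    rw [hW, variance_fun_sub hV2 hρU2, variance_const_mul, covariance_const_mul_right,
      covariance_comm V U, hUV, ← covariance_self hUm, hUU, ← covariance_self hVm, hVV]
    ring
  have hvarU : Var[U; P] = 1 := by rw [← covariance_self hUm, hUU]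
  have hmW : ∫ ω, W ω ∂P = 0 := by
    rw [hW, integral_sub h.snd.integrable (h.fst.integrable.const_mul _), integral_const_mul,
      hU, hV]
    simp
  have hlawU : P.map U = gaussianReal 0 1 := by
    rw [h.fst.map_eq_gaussianReal, hU, hvarU]; simp
  have hlawW : P.map W = gaussianReal 0 (1 - ρ ^ 2).toNNReal := by
    rw [hUW.snd.map_eq_gaussianReal, hmW, hvar]
  have hρ : 0 ≤ 1 - ρ ^ 2 := hvar ▸ variance_nonneg _ _
  have hind : IndepFun U W P := hUW.indepFun_of_covariance_eq_zero hcUW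
  have hmap := hind.map_prod_eq_prod_map_map hUm hWm
  rw [hlawU, hlawW] at hmap
  set μ := gaussianReal 0 (1 - ρ ^ 2).toNNReal
  have hcont : Continuous fun p : ℝ × ℝ =>
      (realHermite k).eval p.1 * (realHermite l).eval (ρ * p.1 + p.2) := by
    have h1 := (realHermite k).continuous
    have h2 := (realHermite l).continuous
    fun_prop
  have hint : Integrable (fun p : ℝ × ℝ =>
      (realHermite k).eval p.1 * (realHermite l).eval (ρ * p.1 + p.2))
      ((gaussianReal 0 1).prod μ) := by
    rw [← hmap, integrable_map_measure hcont.aestronglyMeasurable (hUm.prodMk hWm)]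
    have e : (fun p : ℝ × ℝ => (realHermite k).eval p.1 * (realHermite l).eval (ρ * p.1 + p.2)) ∘
        (fun ω => (U ω, W ω)) = fun ω =>
          (realHermite k).eval (U ω) * (realHermite l).eval (V ω) := by
      ext ω; simp [hW]
    rw [e]
    have hlawV : P.map V = gaussianReal 0 1 := by
      rw [h.snd.map_eq_gaussianReal, hV, ← covariance_self hVm, hVV]; simp
    have m1 : MemLp (fun ω => (realHermite k).eval (U ω)) 2 P := by
      have := memLp_two_eval_gaussianReal (realHermite k) 0 1
      rw [← hlawU] at this
      exact this.comp_of_map hUm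
    have m2 : MemLp (fun ω => (realHermite l).eval (V ω)) 2 P := by
      have := memLp_two_eval_gaussianReal (realHermite l) 0 1
      rw [← hlawV] at this
      exact this.comp_of_map hVm
    exact m1.integrable_mul m2
  calc ∫ ω, (realHermite k).eval (U ω) * (realHermite l).eval (V ω) ∂P
      = ∫ p : ℝ × ℝ, (realHermite k).eval p.1 * (realHermite l).eval (ρ * p.1 + p.2)
          ∂(P.map fun ω => (U ω, W ω)) := by
        rw [integral_map (hUm.prodMk hWm) hcont.aestronglyMeasurable]
        simp [hW]
    _ = ∫ x, (realHermite k).eval x * (ρ ^ l * (realHermite l).eval x) ∂(gaussianReal 0 1) := by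
        rw [hmap, integral_prod _ hint]
        congr with x
        simp only
        rw [integral_const_mul, integral_realHermite_add ρ x _ (Real.coe_toNNReal _ hρ)]
    _ = ρ ^ l * ∫ x, (realHermite k).eval x * (realHermite l).eval x ∂(gaussianReal 0 1) := by
        rw [← integral_const_mul]; congr with x; ring
    _ = _ := by
        rw [integral_realHermite_mul_realHermite]
        split_ifs with hkl
        · rw [hkl]; ring
        · simp

/-- Two centred, jointly Gaussian, standard random vectors whose only nonzero cross-covariances are
those of components with the same index, namely `ρ`. -/
structure IsCorrelatedPair {m : ℕ} (P : Measure Ω) (X Y : Ω → Fin m → ℝ) (ρ : Fin m → ℝ) :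
    Prop where
  measurable_fst : Measurable X
  measurable_snd : Measurable Y
  gaussian : HasGaussianLaw (fun ω => (X ω, Y ω)) P
  mean_fst : ∀ j, ∫ ω, X ω j ∂P = 0
  mean_snd : ∀ j, ∫ ω, Y ω j ∂P = 0
  cov_fst : ∀ i j, cov[fun ω => X ω i, fun ω => X ω j; P] = if i = j then 1 else 0
  cov_snd : ∀ i j, cov[fun ω => Y ω i, fun ω => Y ω j; P] = if i = j then 1 else 0
  cov_cross : ∀ i j, cov[fun ω => X ω i, fun ω => Y ω j; P] = if i = j then ρ j else 0

instance isProbabilityMeasure_stdGauss (m : ℕ) : IsProbabilityMeasure (stdGauss m) := by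
  unfold stdGauss; infer_instance

theorem map_eq_stdGauss {m : ℕ} {X : Ω → Fin m → ℝ} (h : HasGaussianLaw X P)
    (hmean : ∀ j, ∫ ω, X ω j ∂P = 0)
    (hcov : ∀ i j, cov[fun ω => X ω i, fun ω => X ω j; P] = if i = j then 1 else 0) :
    P.map X = stdGauss m := by
  have hind : iIndepFun (fun i ω => X ω i) P :=
    HasGaussianLaw.iIndepFun_of_covariance_eq_zero (X := fun i ω => X ω i) h
      fun i j hij => by simp [hcov, hij]
  have hm : ∀ i, AEMeasurable (fun ω => X ω i) P := fun i => (h.eval i).aemeasurable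
  have := hind.map_fun_eq_pi_map hm
  rw [this, stdGauss]
  congr with i : 1
  rw [(h.eval i).map_eq_gaussianReal, hmean, ← covariance_self (hm i), hcov]
  simp

namespace IsCorrelatedPair

variable {m : ℕ} {X Y : Ω → Fin m → ℝ} {ρ : Fin m → ℝ}

theorem measurePreserving_fst (h : IsCorrelatedPair P X Y ρ) : MeasurePreserving X P (stdGauss m) :=
  ⟨h.measurable_fst, map_eq_stdGauss h.gaussian.fst h.mean_fst h.cov_fst⟩

theorem measurePreserving_snd (h : IsCorrelatedPair P X Y ρ) : MeasurePreserving Y P (stdGauss m) :=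
  ⟨h.measurable_snd, map_eq_stdGauss h.gaussian.snd h.mean_snd h.cov_snd⟩

/-- The pairs `(X_j, Y_j)` are jointly Gaussian and uncorrelated for different `j`, hence
independent, so the expectation factors into one-dimensional ones. -/
theorem integral_hermiteProd (h : IsCorrelatedPair P X Y ρ) (v w : Fin m → ℕ) :
    ∫ ω, hermiteProd v (X ω) * hermiteProd w (Y ω) ∂P =
      if v = w then ∏ j, ((v j).factorial * ρ j ^ v j) else 0 := by
  let Z : (i : Fin m) → Bool → Ω → ℝ := fun i b ω => if b then X ω i else Y ω i
  have hXj : ∀ j : Fin m, HasGaussianLaw (fun ω => (X ω j, Y ω j)) P := fun j =>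
    h.gaussian.map_fun (((ContinuousLinearMap.proj j).comp (ContinuousLinearMap.fst ℝ _ _)).prod
      ((ContinuousLinearMap.proj j).comp (ContinuousLinearMap.snd ℝ _ _)))
  have hZ : HasGaussianLaw (fun ω i b => Z i b ω) P := by
    have := h.gaussian.map_fun (ContinuousLinearMap.pi fun i : Fin m =>
      ContinuousLinearMap.pi fun b : Bool => if b then
        (ContinuousLinearMap.proj (R := ℝ) (φ := fun _ : Fin m => ℝ) i).comp
          (ContinuousLinearMap.fst ℝ (Fin m → ℝ) (Fin m → ℝ))
        else (ContinuousLinearMap.proj (R := ℝ) (φ := fun _ : Fin m => ℝ) i).comp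
          (ContinuousLinearMap.snd ℝ (Fin m → ℝ) (Fin m → ℝ)))
    convert! this using 1
    ext ω i b
    cases b <;> simp [Z]
  have hind : iIndepFun (fun i ω b => Z i b ω) P := by
    refine hZ.iIndepFun_of_covariance_eval fun i j hij a b => ?_
    cases a <;> cases b <;>
      simp only [Z, if_true, if_false, Bool.false_eq_true]
    · simp [h.cov_snd, hij]
    · rw [covariance_comm]; simp [h.cov_cross, hij.symm]
    · simp [h.cov_cross, hij]
    · simp [h.cov_fst, hij]
  let f : Fin m → (Bool → ℝ) → ℝ := fun j z =>
    (realHermite (v j)).eval (z true) * (realHermite (w j)).eval (z false)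
  have hf : ∀ j, Continuous (f j) := fun j =>
    (((realHermite (v j)).continuous.comp (continuous_apply true))).mul
      ((realHermite (w j)).continuous.comp (continuous_apply false))
  have hprod : ∀ ω, hermiteProd v (X ω) * hermiteProd w (Y ω) =
      ∏ j, f j ((fun i ω b => Z i b ω) j ω) := by
    intro ω
    simp [hermiteProd, aeval_hermite, f, Z, Finset.prod_mul_distrib]
  simp_rw [hprod]
  rw [hind.integral_fun_prod_comp (fun i => (hZ.eval i).aemeasurable)
    (fun i => (hf i).aestronglyMeasurable)]
  have hone : ∀ j, ∫ ω, f j (fun b => Z j b ω) ∂P =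
      if v j = w j then ((v j).factorial : ℝ) * ρ j ^ v j else 0 := fun j => by
    simpa [f, Z] using integral_realHermite_pair (hXj j) (h.mean_fst j) (h.mean_snd j)
      (by simpa using h.cov_fst j j) (by simpa using h.cov_snd j j)
      (by simpa using h.cov_cross j j) (v j) (w j)
  simp_rw [hone]
  split_ifs with hvw
  · subst hvw; simp
  · obtain ⟨j, hj⟩ := Function.ne_iff.1 hvw
    exact Finset.prod_eq_zero (Finset.mem_univ j) (if_neg hj)

/-- The variances of `X_j ± Y_j` are `2 ± 2 ρ_j`. -/
theorem abs_le_one (h : IsCorrelatedPair P X Y ρ) (j : Fin m) : |ρ j| ≤ 1 := by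
  have := h.gaussian.isProbabilityMeasure
  have hX : MemLp (fun ω => X ω j) 2 P := (h.gaussian.fst.eval j).memLp_two
  have hY : MemLp (fun ω => Y ω j) 2 P := (h.gaussian.snd.eval j).memLp_two
  have h1 := variance_nonneg (fun ω => X ω j - Y ω j) P
  have h2 := variance_nonneg (fun ω => X ω j + Y ω j) P
  rw [variance_fun_sub hX hY] at h1
  rw [variance_fun_add hX hY] at h2
  rw [← covariance_self hX.aemeasurable, ← covariance_self hY.aemeasurable, h.cov_fst, h.cov_snd,
    h.cov_cross] at h1 h2
  simp only [if_true] at h1 h2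
  exact abs_le.2 ⟨by linarith, by linarith⟩

end IsCorrelatedPair

theorem memLp_hermiteProd {m : ℕ} (v : Fin m → ℕ) : MemLp (hermiteProd v) 2 (stdGauss m) := by
  have hc : Continuous (hermiteProd v) :=
    continuous_finsetProd _ fun j _ => by
      simp_rw [aeval_hermite]
      exact (realHermite (v j)).continuous.comp (continuous_apply j)
  rw [memLp_two_iff_integrable_sq hc.aestronglyMeasurable]
  have := Integrable.fintype_prod (μ := fun _ : Fin m => gaussianReal 0 1)
    (f := fun j x => (realHermite (v j)).eval x ^ 2) (𝕜 := ℝ)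
    fun j => (memLp_two_eval_gaussianReal (realHermite (v j)) 0 1).integrable_sq
  refine this.congr (ae_of_all _ fun x => ?_)
  simp [hermiteProd, aeval_hermite, Finset.prod_pow]

end Pair

/-! ### Completeness of the Hermite products -/

section Completeness

/-- An integrable function whose Fourier transform vanishes is zero almost everywhere. -/
theorem ae_eq_zero_of_integral_mul_cexp_eq_zero {E : Type*} [NormedAddCommGroup E]
    [NormedSpace ℝ E] [CompleteSpace E] [MeasurableSpace E] [BorelSpace E]
    [SecondCountableTopology E] {μ : Measure E} [IsFiniteMeasure μ] {F : E → ℝ}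
    (hF : Integrable F μ)
    (h : ∀ l : StrongDual ℝ E, ∫ x, (F x : ℂ) * Complex.exp (l x * Complex.I) ∂μ = 0) :
    F =ᵐ[μ] 0 := by
  have hp : AEMeasurable (fun x => ENNReal.ofReal (F x)) μ := hF.aemeasurable.ennreal_ofReal
  have hn : AEMeasurable (fun x => ENNReal.ofReal (-F x)) μ := hF.neg.aemeasurable.ennreal_ofReal
  have hfp : ∫⁻ x, ENNReal.ofReal (F x) ∂μ ≠ ⊤ := hF.lintegral_lt_top.ne
  have hfn : ∫⁻ x, ENNReal.ofReal (-F x) ∂μ ≠ ⊤ := hF.neg.lintegral_lt_top.ne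
  have := isFiniteMeasure_withDensity hfp
  have := isFiniteMeasure_withDensity hfn
  -- The finite measures `F⁺ μ` and `F⁻ μ` have the same characteristic function, so they coincide.
  -- Their densities then agree almost everywhere, and since one of them vanishes at each point,
  -- both do.
  have key : μ.withDensity (fun x => ENNReal.ofReal (F x)) =
      μ.withDensity (fun x => ENNReal.ofReal (-F x)) := by
    refine Measure.ext_of_charFunDual ?_
    ext l
    rw [charFunDual_apply, charFunDual_apply,
      integral_withDensity_eq_integral_toReal_smul₀ hp (by simp),
      integral_withDensity_eq_integral_toReal_smul₀ hn (by simp), ← sub_eq_zero]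
    have hcont : Continuous fun x : E => Complex.exp (l x * Complex.I) := by fun_prop
    have hbd : ∀ x : E, ‖Complex.exp (l x * Complex.I)‖ ≤ 1 := fun x => by
      rw [Complex.norm_exp_ofReal_mul_I]
    have hint : ∀ f : E → ℝ, Integrable f μ →
        Integrable (fun x => f x • Complex.exp (l x * Complex.I)) μ := fun f hf =>
      hf.smul_bdd 1 hcont.aestronglyMeasurable (ae_of_all _ hbd)
    rw [← integral_sub, ← h l]
    · congr with x
      rw [← sub_smul, ENNReal.toReal_ofReal', ENNReal.toReal_ofReal', Complex.real_smul]
      congr 2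
      rcases le_total 0 (F x) with hx | hx
      · rw [max_eq_left hx, max_eq_right (by linarith)]; ring
      · rw [max_eq_right hx, max_eq_left (by linarith)]; ring
    · exact hint _ (integrable_toReal_of_lintegral_ne_top hp hfp)
    · exact hint _ (integrable_toReal_of_lintegral_ne_top hn hfn)
  rw [withDensity_eq_iff hp hn hfp] at key
  filter_upwards [key] with x hx
  rcases le_total 0 (F x) with h0 | h0
  · rw [ENNReal.ofReal_of_nonpos (p := -F x) (by linarith), ENNReal.ofReal_eq_zero] at hx
    exact le_antisymm hx h0
  · rw [ENNReal.ofReal_of_nonpos h0, eq_comm, ENNReal.ofReal_eq_zero] at hx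
    exact le_antisymm h0 (neg_nonpos.1 hx)

variable {m : ℕ}

theorem hermiteProd_update (v : Fin m → ℕ) (j : Fin m) (k : ℕ) (x : Fin m → ℝ) :
    hermiteProd (Function.update v j k) x = (realHermite k).eval (x j) *
      ∏ i ∈ Finset.univ.erase j, (realHermite (v i)).eval (x i) := by
  unfold hermiteProd
  rw [← Finset.mul_prod_erase _ _ (Finset.mem_univ j)]
  simp only [aeval_hermite, Function.update_self]
  congr 1
  refine Finset.prod_congr rfl fun i hi => ?_
  rw [Function.update_of_ne (Finset.ne_of_mem_erase hi)]

/-- The three-term recurrence. When `v j = 0` the truncated `v j - 1` is harmless, because its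
coefficient is zero. -/
theorem coord_mul_hermiteProd (v : Fin m → ℕ) (j : Fin m) (x : Fin m → ℝ) :
    x j * hermiteProd v x = hermiteProd (Function.update v j (v j + 1)) x +
      v j * hermiteProd (Function.update v j (v j - 1)) x := by
  conv_lhs => rw [← Function.update_eq_self j v]
  simp only [hermiteProd_update]
  rw [realHermite_succ]
  cases v j with
  | zero => simp [realHermite_zero]
  | succ n =>
    rw [derivative_realHermite_succ]
    simp
    ring

/-- By the recurrence, the span of the Hermite products is stable under multiplication by
coordinates and hence by linear forms. -/
theorem pow_mem_span_hermiteProd (l : (Fin m → ℝ) →L[ℝ] ℝ) (n : ℕ) :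
    (fun x => l x ^ n) ∈ Submodule.span ℝ (Set.range (hermiteProd (m := m))) := by
  have hl : ∀ x, l x = ∑ j, x j * l (Pi.single j 1) := fun x => by
    have hx : x = ∑ j, x j • (Pi.single j 1 : Fin m → ℝ) := by
      ext i
      simp [Finset.sum_apply, Pi.single_apply]
    conv_lhs => rw [hx]
    rw [map_sum]
    refine Finset.sum_congr rfl fun j _ => ?_
    rw [map_smul, smul_eq_mul]
  have hcoord : ∀ f ∈ Submodule.span ℝ (Set.range (hermiteProd (m := m))), ∀ j,
      (fun x => x j * f x) ∈ Submodule.span ℝ (Set.range (hermiteProd (m := m))) := by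
    intro f hf j
    induction hf using Submodule.span_induction with
    | mem f hf =>
      obtain ⟨v, rfl⟩ := hf
      have : (fun x => x j * hermiteProd v x) = hermiteProd (Function.update v j (v j + 1)) +
          (v j : ℝ) • hermiteProd (Function.update v j (v j - 1)) := by
        ext x; simp [coord_mul_hermiteProd]
      rw [this]
      exact Submodule.add_mem _ (Submodule.subset_span ⟨_, rfl⟩)
        (Submodule.smul_mem _ _ (Submodule.subset_span ⟨_, rfl⟩))
    | zero =>
      have : (fun x : Fin m → ℝ => x j * (0 : (Fin m → ℝ) → ℝ) x) = 0 := by ext x; simp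
      rw [this]
      exact Submodule.zero_mem _
    | add f g _ _ hf hg =>
      convert! Submodule.add_mem _ hf hg using 1
      ext x; simp [mul_add]
    | smul c f _ hf =>
      convert! Submodule.smul_mem _ c hf using 1
      ext x; simp; ring
  induction n with
  | zero =>
    refine Submodule.subset_span ⟨0, ?_⟩
    ext x; simp [hermiteProd]
  | succ n ih =>
    have : (fun x => l x ^ (n + 1)) =
        ∑ j, l (Pi.single j 1) • fun x : Fin m → ℝ => x j * l x ^ n := by
      ext x
      simp only [Finset.sum_apply, Pi.smul_apply, smul_eq_mul]
      rw [pow_succ', hl x, Finset.sum_mul, ← hl x]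
      exact Finset.sum_congr rfl fun j _ => by ring
    rw [this]
    exact Submodule.sum_mem _ fun j _ => Submodule.smul_mem _ _ (hcoord _ ih j)

instance isGaussian_stdGauss (m : ℕ) : IsGaussian (stdGauss m) := by
  rw [← isGaussian_map_equiv_iff (PiLp.continuousLinearEquiv 2 ℝ (fun _ : Fin m => ℝ)).symm]
  have := map_pi_eq_stdGaussian (ι := Fin m)
  change IsGaussian ((Measure.pi fun _ => gaussianReal 0 1).map (WithLp.toLp 2))
  rw [this]
  infer_instance

theorem memLp_exp_abs_stdGauss (l : (Fin m → ℝ) →L[ℝ] ℝ) :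
    MemLp (fun x => Real.exp |l x|) 2 (stdGauss m) := by
  rw [memLp_two_iff_integrable_sq (by fun_prop)]
  have hexp : ∀ t : ℝ, Integrable (fun x => Real.exp (t * l x)) (stdGauss m) := by
    intro t
    have := integrable_exp_mul_gaussianReal (μ := (stdGauss m)[l])
      (v := Var[l; stdGauss m].toNNReal) t
    rw [← IsGaussian.map_eq_gaussianReal l, integrable_map_measure (by fun_prop) (by fun_prop)]
      at this
    exact this
  refine ((hexp 2).add (hexp (-2))).mono' (by fun_prop) (ae_of_all _ fun x => ?_)
  rw [Real.norm_of_nonneg (by positivity), ← Real.exp_nat_mul]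
  simp only [Pi.add_apply]
  rcases abs_cases (l x) with ⟨h, _⟩ | ⟨h, _⟩ <;> rw [h]
  · push_cast; linarith [Real.exp_pos (-2 * l x)]
  · push_cast
    rw [show (2 : ℝ) * -l x = -2 * l x by ring]
    linarith [Real.exp_pos (2 * l x)]

/-- The Hermite products are complete in `L²(γ_m)`. -/
theorem ae_eq_zero_of_hermiteCoeff_eq_zero {F : (Fin m → ℝ) → ℝ} (hF : MemLp F 2 (stdGauss m))
    (h : ∀ v, hermiteCoeff F v = 0) : F =ᵐ[stdGauss m] 0 := by
  refine ae_eq_zero_of_integral_mul_cexp_eq_zero (hF.integrable (by norm_num)) fun l => ?_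
  have hpow : ∀ n : ℕ, ∫ x, F x * l x ^ n ∂(stdGauss m) = 0 := by
    intro n
    have : ∀ f ∈ Submodule.span ℝ (Set.range (hermiteProd (m := m))),
        Integrable (fun x => F x * f x) (stdGauss m) ∧ ∫ x, F x * f x ∂(stdGauss m) = 0 := by
      intro f hf
      induction hf using Submodule.span_induction with
      | mem f hf =>
        obtain ⟨v, rfl⟩ := hf
        exact ⟨hF.integrable_mul (memLp_hermiteProd v), h v⟩
      | zero => simp
      | add f g _ _ hf hg =>
        have hi : Integrable (fun x => F x * f x + F x * g x) (stdGauss m) := hf.1.add hg.1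
        simp only [Pi.add_apply, mul_add]
        refine ⟨hi, ?_⟩
        rw [integral_add hf.1 hg.1, hf.2, hg.2, add_zero]
      | smul c f _ hf =>
        have e : (fun x => F x * (c • f) x) = fun x => c * (F x * f x) := by
          ext x; simp; ring
        rw [e]
        exact ⟨hf.1.const_mul c, by rw [integral_const_mul, hf.2, mul_zero]⟩
    exact (this _ (pow_mem_span_hermiteProd l n)).2
  -- Expand the exponential in powers of `l` and integrate termwise. The dominating function `|F|
  -- exp |l|` is a product of two `L²` functions, and every term is a multiple of a vanishing moment
  -- `∫ F l ^ n`.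
  have hsum : ∀ x, HasSum (fun n : ℕ => (F x : ℂ) * ((l x * Complex.I) ^ n / (n.factorial : ℂ)))
      ((F x : ℂ) * Complex.exp (l x * Complex.I)) := fun x => by
    have := NormedSpace.expSeries_div_hasSum_exp (𝔸 := ℂ) (l x * Complex.I)
    rw [← Complex.exp_eq_exp_ℂ] at this
    exact this.mul_left _
  have hbsum : ∀ x, HasSum (fun n : ℕ => |F x| * (|l x| ^ n / (n.factorial : ℝ)))
      (|F x| * Real.exp |l x|) := fun x => by
    have := NormedSpace.expSeries_div_hasSum_exp (𝔸 := ℝ) |l x|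
    rw [← Real.exp_eq_exp_ℝ] at this
    exact this.mul_left _
  have hmain := hasSum_integral_of_dominated_convergence (μ := stdGauss m)
    (F := fun (n : ℕ) x => (F x : ℂ) * ((l x * Complex.I) ^ n / (n.factorial : ℂ)))
    (f := fun x => (F x : ℂ) * Complex.exp (l x * Complex.I))
    (fun n x => |F x| * (|l x| ^ n / (n.factorial : ℝ)))
    (fun n => (Complex.continuous_ofReal.comp_aestronglyMeasurable hF.1).mul
      (Continuous.aestronglyMeasurable (by fun_prop)))
    (fun n => ae_of_all _ fun x => by simp)
    (ae_of_all _ fun x => (hbsum x).summable)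
    (by
      simp_rw [fun x => (hbsum x).tsum_eq]
      exact hF.abs.integrable_mul (memLp_exp_abs_stdGauss l))
    (ae_of_all _ hsum)
  have hzero : ∀ n : ℕ, ∫ x, (F x : ℂ) * ((l x * Complex.I) ^ n / (n.factorial : ℂ))
      ∂(stdGauss m) = 0 := by
    intro n
    have e : ∀ x, (F x : ℂ) * ((l x * Complex.I) ^ n / (n.factorial : ℂ)) =
        (Complex.I ^ n / (n.factorial : ℂ)) * ((F x * l x ^ n : ℝ) : ℂ) := by
      intro x; push_cast; ring
    simp_rw [e]
    rw [integral_const_mul, integral_complex_ofReal, hpow]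
    simp
  simp_rw [hzero] at hmain
  exact hmain.unique hasSum_zero

theorem integral_hermiteProd_mul_hermiteProd (v w : Fin m → ℕ) :
    ∫ x, hermiteProd v x * hermiteProd w x ∂(stdGauss m) =
      if v = w then ((∏ j, (v j).factorial : ℕ) : ℝ) else 0 := by
  simp_rw [hermiteProd, ← Finset.prod_mul_distrib, aeval_hermite]
  rw [stdGauss, integral_fintype_prod_eq_prod
    (f := fun j x => (realHermite (v j)).eval x * (realHermite (w j)).eval x)]
  simp_rw [integral_realHermite_mul_realHermite]
  split_ifs with hvw
  · subst hvw; simp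
  · obtain ⟨j, hj⟩ := Function.ne_iff.1 hvw
    exact Finset.prod_eq_zero (Finset.mem_univ j) (if_neg hj)

/-- The normalized Hermite product `e_v / √(v!)` as an element of `L²(γ_m)`. -/
noncomputable def hermiteLp (v : Fin m → ℕ) : Lp ℝ 2 (stdGauss m) :=
  (√(∏ j, (v j).factorial : ℕ))⁻¹ • (memLp_hermiteProd v).toLp _

theorem inner_toLp_toLp {α : Type*} [MeasurableSpace α] {μ : Measure α} {f g : α → ℝ}
    (hf : MemLp f 2 μ) (hg : MemLp g 2 μ) :
    inner ℝ (hf.toLp f) (hg.toLp g) = ∫ x, f x * g x ∂μ := by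
  rw [L2.inner_def]
  refine integral_congr_ae ?_
  filter_upwards [hf.coeFn_toLp, hg.coeFn_toLp] with x h1 h2
  rw [h1, h2]
  simp [mul_comm]

theorem prod_factorial_pos (v : Fin m → ℕ) : (0 : ℝ) < (∏ j, (v j).factorial : ℕ) := by
  exact_mod_cast Finset.prod_pos fun j _ => Nat.factorial_pos _

theorem inner_hermiteLp_toLp (v : Fin m → ℕ) {F : (Fin m → ℝ) → ℝ} (hF : MemLp F 2 (stdGauss m)) :
    inner ℝ (hermiteLp v) (hF.toLp F) = (√(∏ j, (v j).factorial : ℕ))⁻¹ * hermiteCoeff F v := by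
  rw [hermiteLp, real_inner_smul_left, inner_toLp_toLp, hermiteCoeff]
  simp_rw [mul_comm (F _)]

theorem orthonormal_hermiteLp : Orthonormal ℝ (hermiteLp (m := m)) := by
  rw [orthonormal_iff_ite]
  intro v w
  rw [hermiteLp, hermiteLp, real_inner_smul_left, real_inner_smul_right, inner_toLp_toLp,
    integral_hermiteProd_mul_hermiteProd]
  split_ifs with hvw
  · subst hvw
    have h := prod_factorial_pos v
    rw [← mul_assoc, ← mul_inv, Real.mul_self_sqrt h.le, inv_mul_cancel₀ h.ne']
  · simp

/-- The Hermite basis of `L²(γ_m)`. -/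
noncomputable def hermiteBasis (m : ℕ) : HilbertBasis (Fin m → ℕ) ℝ (Lp ℝ 2 (stdGauss m)) :=
  HilbertBasis.mkOfOrthogonalEqBot orthonormal_hermiteLp (by
    rw [eq_bot_iff]
    intro f hf
    rw [Submodule.mem_bot]
    have hf2 := Lp.memLp f
    have hfe : hf2.toLp f = f := Lp.toLp_coeFn f hf2
    have := ae_eq_zero_of_hermiteCoeff_eq_zero hf2 fun v => by
      have h0 := (Submodule.mem_orthogonal _ _).1 hf (hermiteLp v) (Submodule.subset_span ⟨v, rfl⟩)
      rw [← hfe, inner_hermiteLp_toLp] at h0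
      have h1 := Real.sqrt_pos.2 (prod_factorial_pos v)
      exact (mul_eq_zero.1 h0).resolve_left (inv_ne_zero h1.ne')
    exact (Lp.eq_zero_iff_ae_eq_zero).2 this)

theorem hermiteBasis_apply (v : Fin m → ℕ) : hermiteBasis m v = hermiteLp v := by
  simp [hermiteBasis]

/-- Parseval's identity. -/
theorem hasSum_sq_hermiteCoeff {F : (Fin m → ℝ) → ℝ} (hF : MemLp F 2 (stdGauss m)) :
    HasSum (fun v : Fin m → ℕ => hermiteCoeff F v ^ 2 / (∏ j, (v j).factorial : ℕ))
      (∫ x, F x ^ 2 ∂(stdGauss m)) := by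
  have h := (hermiteBasis m).hasSum_inner_mul_inner (hF.toLp F) (hF.toLp F)
  rw [inner_toLp_toLp] at h
  simp_rw [← pow_two] at h
  convert! h using 2 with v
  rw [hermiteBasis_apply, real_inner_comm, inner_hermiteLp_toLp, ← pow_two, mul_pow, inv_pow,
    Real.sq_sqrt (prod_factorial_pos v).le]
  ring

/-! ### Mehler's formula in several variables -/

namespace IsCorrelatedPair

variable {Ω : Type*} [MeasurableSpace Ω] {P : Measure Ω} {X Y : Ω → Fin m → ℝ} {ρ : Fin m → ℝ}

/-- Composition with `X` and with `Y` embeds `L²(γ_m)` isometrically into `L²(P)`. The inner product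
between the two images is diagonal in the Hermite basis, with entries `∏ ρ_j ^ v_j`; expanding `F`
in both arguments gives the series. -/
theorem hasSum_integral (h : IsCorrelatedPair P X Y ρ) {F : (Fin m → ℝ) → ℝ}
    (hF : MemLp F 2 (stdGauss m)) :
    HasSum (fun v : Fin m → ℕ => hermiteCoeff F v ^ 2 / (∏ j, (v j).factorial : ℕ) *
      ∏ j, ρ j ^ v j) (∫ ω, F (X ω) * F (Y ω) ∂P) := by
  let TX := Lp.compMeasurePreservingₗᵢ ℝ X h.measurePreserving_fst (E := ℝ) (p := 2)
  let TY := Lp.compMeasurePreservingₗᵢ ℝ Y h.measurePreserving_snd (E := ℝ) (p := 2)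
  have hTX : ∀ (f : (Fin m → ℝ) → ℝ) (hf : MemLp f 2 (stdGauss m)),
      TX (hf.toLp f) = (hf.comp_measurePreserving h.measurePreserving_fst).toLp _ := fun f hf =>
    Lp.toLp_compMeasurePreserving hf h.measurePreserving_fst
  have hTY : ∀ (f : (Fin m → ℝ) → ℝ) (hf : MemLp f 2 (stdGauss m)),
      TY (hf.toLp f) = (hf.comp_measurePreserving h.measurePreserving_snd).toLp _ := fun f hf =>
    Lp.toLp_compMeasurePreserving hf h.measurePreserving_snd
  have hbb : ∀ v w, inner ℝ (TX (hermiteLp v)) (TY (hermiteLp w)) =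
      if v = w then ∏ j, ρ j ^ v j else 0 := by
    intro v w
    rw [hermiteLp, hermiteLp, map_smul, map_smul, hTX, hTY, real_inner_smul_left,
      real_inner_smul_right, inner_toLp_toLp]
    have := h.integral_hermiteProd v w
    simp only [Function.comp_apply]
    rw [this]
    split_ifs with hvw
    · subst hvw
      have h := prod_factorial_pos v
      rw [← mul_assoc, ← mul_inv, Real.mul_self_sqrt h.le, Finset.prod_mul_distrib]
      push_cast at h ⊢
      rw [inv_mul_cancel_left₀ h.ne']
    · simp
  have hF' : HasSum (fun v => ((√(∏ j, (v j).factorial : ℕ))⁻¹ * hermiteCoeff F v) • hermiteLp v)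
      (hF.toLp F) := by
    have := (hermiteBasis m).hasSum_repr (hF.toLp F)
    simpa only [HilbertBasis.repr_apply_apply, hermiteBasis_apply, inner_hermiteLp_toLp] using this
  have hY : ∀ v, inner ℝ (TX (hermiteLp v)) (TY (hF.toLp F)) =
      (√(∏ j, (v j).factorial : ℕ))⁻¹ * hermiteCoeff F v * ∏ j, ρ j ^ v j := by
    intro v
    have h1 := (hF'.mapL TY.toContinuousLinearMap).mapL (innerSL ℝ (TX (hermiteLp v)))
    have h2 : HasSum (fun w => if w = v then
        (√(∏ j, (v j).factorial : ℕ))⁻¹ * hermiteCoeff F v * ∏ j, ρ j ^ v j else 0)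
        (inner ℝ (TX (hermiteLp v)) (TY (hF.toLp F))) := by
      convert! h1 using 2 with w
      simp only [LinearIsometry.coe_toContinuousLinearMap, map_smul, innerSL_apply_apply,
        smul_eq_mul, hbb]
      by_cases hvw : w = v
      · subst hvw; simp
      · simp [hvw, Ne.symm hvw]
    exact h2.unique (hasSum_ite_eq v _)
  have h1 := (hF'.mapL TX.toContinuousLinearMap).mapL (innerSL ℝ (TY (hF.toLp F)))
  have h2 : ∫ ω, F (X ω) * F (Y ω) ∂P = inner ℝ (TY (hF.toLp F)) (TX (hF.toLp F)) := by
    rw [real_inner_comm, hTX, hTY, inner_toLp_toLp]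
    rfl
  rw [h2]
  convert! h1 using 2 with v
  simp only [LinearIsometry.coe_toContinuousLinearMap, map_smul, innerSL_apply_apply,
    smul_eq_mul]
  rw [real_inner_comm, hY]
  have h3 := Real.sq_sqrt (prod_factorial_pos v).le
  rw [← h3]
  have h4 := (Real.sqrt_pos.2 (prod_factorial_pos v)).ne'
  rw [Real.sqrt_sq (Real.sqrt_nonneg _)]
  field_simp

/-- Correlations of a function without Hermite coefficients of degree at most `n` are bounded by
the `n + 1`-st power of the maximal correlation. -/
theorem abs_integral_le (h : IsCorrelatedPair P X Y ρ) {F : (Fin m → ℝ) → ℝ}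
    (hF : MemLp F 2 (stdGauss m)) {n : ℕ} (hn : ∀ v, ∑ j, v j ≤ n → hermiteCoeff F v = 0)
    {R : ℝ} (hR0 : 0 ≤ R) (hR1 : R ≤ 1) (hR : ∀ j, |ρ j| ≤ R) :
    |∫ ω, F (X ω) * F (Y ω) ∂P| ≤ R ^ (n + 1) * ∫ x, F x ^ 2 ∂(stdGauss m) := by
  have h1 := h.hasSum_integral hF
  have h2 := (hasSum_sq_hermiteCoeff hF).mul_left (R ^ (n + 1))
  have hb : ∀ v : Fin m → ℕ, |hermiteCoeff F v ^ 2 / (∏ j, (v j).factorial : ℕ) *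
      ∏ j, ρ j ^ v j| ≤ R ^ (n + 1) * (hermiteCoeff F v ^ 2 / (∏ j, (v j).factorial : ℕ)) := by
    intro v
    rcases le_or_gt (∑ j, v j) n with hv | hv
    · simp [hn v hv]
    have h0 : 0 ≤ hermiteCoeff F v ^ 2 / (∏ j, (v j).factorial : ℕ) :=
      div_nonneg (sq_nonneg _) (prod_factorial_pos v).le
    rw [abs_mul, abs_of_nonneg h0, mul_comm]
    refine mul_le_mul_of_nonneg_right ?_ h0
    rw [Finset.abs_prod]
    calc ∏ j, |ρ j ^ v j| ≤ ∏ j, R ^ v j :=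
          Finset.prod_le_prod (fun _ _ => abs_nonneg _) fun j _ => by
            rw [abs_pow]; exact pow_le_pow_left₀ (abs_nonneg _) (hR j) _
      _ = R ^ ∑ j, v j := Finset.prod_pow_eq_pow_sum _ _ _
      _ ≤ R ^ (n + 1) := pow_le_pow_of_le_one hR0 hR1 hv
  rw [abs_le]
  constructor
  · exact hasSum_le (fun v => (abs_le.1 (hb v)).1) h2.neg h1
  · exact hasSum_le (fun v => (abs_le.1 (hb v)).2) h1 h2

end IsCorrelatedPair

end Completeness

/-! ### Integrals of measurable fields with constant marginal law -/

section RandomField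

variable {Ω S T : Type*} [MeasurableSpace Ω] [MeasurableSpace S] [MeasurableSpace T]
  {P : Measure Ω} [IsProbabilityMeasure P] {γ : Measure T} {ξ : S → Ω → T}

/-- Joint measurability and equal marginals put `f ∘ ξ` in `L²(μ ⊗ P)` for `f ∈ L²(γ)` and finite
`μ`. All later uses of Fubini rest on this; no regularity of paths is needed. -/
theorem map_uncurry_prod (hm : Measurable fun p : S × Ω => ξ p.1 p.2)
    (hlaw : ∀ x, P.map (ξ x) = γ) (μ : Measure S) [SFinite μ] :
    (μ.prod P).map (fun p => ξ p.1 p.2) = μ Set.univ • γ := by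
  ext s hs
  rw [Measure.map_apply hm hs, Measure.prod_apply (hm hs), Measure.smul_apply, smul_eq_mul]
  have : ∀ x, P (Prod.mk x ⁻¹' ((fun p : S × Ω => ξ p.1 p.2) ⁻¹' s)) = γ s := by
    intro x
    have hx : Measurable (ξ x) := hm.comp measurable_prodMk_left
    rw [← hlaw x, Measure.map_apply hx hs]
    rfl
  simp_rw [this]
  rw [lintegral_const, mul_comm]

theorem memLp_two_uncurry (hm : Measurable fun p : S × Ω => ξ p.1 p.2)
    (hlaw : ∀ x, P.map (ξ x) = γ) (μ : Measure S) [IsFiniteMeasure μ] {f : T → ℝ}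
    (hf : MemLp f 2 γ) : MemLp (fun p : S × Ω => f (ξ p.1 p.2)) 2 (μ.prod P) := by
  have h : MemLp f 2 ((μ.prod P).map (fun p => ξ p.1 p.2)) := by
    rw [map_uncurry_prod hm hlaw μ]
    exact hf.smul_measure (measure_ne_top μ _)
  exact h.comp_of_map hm.aemeasurable

theorem ae_integrable_comp (hm : Measurable fun p : S × Ω => ξ p.1 p.2)
    (hlaw : ∀ x, P.map (ξ x) = γ) (μ : Measure S) [IsFiniteMeasure μ] {f : T → ℝ}
    (hf : MemLp f 2 γ) : ∀ᵐ ω ∂P, Integrable (fun x => f (ξ x ω)) μ :=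
  ((memLp_two_uncurry hm hlaw μ hf).integrable (by norm_num)).prod_left_ae

theorem integral_integral_comp (hm : Measurable fun p : S × Ω => ξ p.1 p.2)
    (hlaw : ∀ x, P.map (ξ x) = γ) (μ : Measure S) [IsFiniteMeasure μ] {f : T → ℝ}
    (hf : MemLp f 2 γ) : ∫ ω, ∫ x, f (ξ x ω) ∂μ ∂P = μ.real Set.univ * ∫ t, f t ∂γ := by
  rw [← integral_integral_swap
    (f := fun x ω => f (ξ x ω)) ((memLp_two_uncurry hm hlaw μ hf).integrable (by norm_num))]
  have : ∀ x, ∫ ω, f (ξ x ω) ∂P = ∫ t, f t ∂γ := by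
    intro x
    have hx : AEMeasurable (ξ x) P := (hm.comp measurable_prodMk_left).aemeasurable
    rw [← hlaw x, integral_map hx]
    rw [hlaw x]
    exact hf.1
  simp_rw [this]
  simp

theorem integrable_mul_uncurry (hm : Measurable fun p : S × Ω => ξ p.1 p.2)
    (hlaw : ∀ x, P.map (ξ x) = γ) (μ : Measure S) [IsFiniteMeasure μ] {f : T → ℝ}
    (hf : MemLp f 2 γ) :
    Integrable (fun p : (S × S) × Ω => f (ξ p.1.1 p.2) * f (ξ p.1.2 p.2))
      ((μ.prod μ).prod P) := by
  have h1 := memLp_two_uncurry (ξ := fun q : S × S => ξ q.1) (P := P) (γ := γ)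
    (hm.comp ((measurable_fst.comp measurable_fst).prodMk measurable_snd)) (fun q => hlaw q.1)
    (μ.prod μ) hf
  have h2 := memLp_two_uncurry (ξ := fun q : S × S => ξ q.2) (P := P) (γ := γ)
    (hm.comp ((measurable_snd.comp measurable_fst).prodMk measurable_snd)) (fun q => hlaw q.2)
    (μ.prod μ) hf
  exact h1.integrable_mul h2

theorem memLp_two_integral_comp (hm : Measurable fun p : S × Ω => ξ p.1 p.2)
    (hlaw : ∀ x, P.map (ξ x) = γ) (μ : Measure S) [IsFiniteMeasure μ] {f : T → ℝ}
    (hf : MemLp f 2 γ) : MemLp (fun ω => ∫ x, f (ξ x ω) ∂μ) 2 P := by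
  have hmeas : AEStronglyMeasurable (fun ω => ∫ x, f (ξ x ω) ∂μ) P :=
    ((memLp_two_uncurry hm hlaw μ hf).integrable (by norm_num)).integral_prod_right.1
  rw [memLp_two_iff_integrable_sq hmeas]
  refine (integrable_mul_uncurry hm hlaw μ hf).integral_prod_right.congr (ae_of_all _ fun ω => ?_)
  simp only
  rw [integral_prod_mul (fun x => f (ξ x ω)) (fun x => f (ξ x ω)), pow_two]

theorem integral_sq_integral_comp (hm : Measurable fun p : S × Ω => ξ p.1 p.2)
    (hlaw : ∀ x, P.map (ξ x) = γ) (μ : Measure S) [IsFiniteMeasure μ] {f : T → ℝ}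
    (hf : MemLp f 2 γ) :
    ∫ ω, (∫ x, f (ξ x ω) ∂μ) ^ 2 ∂P =
      ∫ q : S × S, ∫ ω, f (ξ q.1 ω) * f (ξ q.2 ω) ∂P ∂(μ.prod μ) := by
  rw [integral_integral_swap (f := fun (q : S × S) ω => f (ξ q.1 ω) * f (ξ q.2 ω))
    (integrable_mul_uncurry hm hlaw μ hf)]
  congr with ω
  rw [integral_prod_mul (fun x => f (ξ x ω)) (fun x => f (ξ x ω)), pow_two]

theorem integrable_integral_mul (hm : Measurable fun p : S × Ω => ξ p.1 p.2)
    (hlaw : ∀ x, P.map (ξ x) = γ) (μ : Measure S) [IsFiniteMeasure μ] {f : T → ℝ}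
    (hf : MemLp f 2 γ) :
    Integrable (fun q : S × S => ∫ ω, f (ξ q.1 ω) * f (ξ q.2 ω) ∂P) (μ.prod μ) :=
  (integrable_mul_uncurry hm hlaw μ hf).integral_prod_left

end RandomField

/-! ### Pairs of values of the long-memory field -/

section Field

variable {Ω : Type*} [MeasurableSpace Ω] {P : Measure Ω} {d m : ℕ}
  {η : EuclideanSpace ℝ (Fin d) → Ω → (Fin m → ℝ)} {α : Fin m → ℝ} {L : Fin m → ℝ → ℝ}

/-- The correlation function of the `j`-th component of the field. -/
noncomputable def corr (α : Fin m → ℝ) (L : Fin m → ℝ → ℝ) (z : EuclideanSpace ℝ (Fin d))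
    (j : Fin m) : ℝ :=
  if z = 0 then 1 else ‖z‖ ^ (-α j) * L j ‖z‖

theorem IsLongMemoryField.isCorrelatedPair (h : IsLongMemoryField P η α L)
    (x y : EuclideanSpace ℝ (Fin d)) : IsCorrelatedPair P (η x) (η y) (corr α L (x - y)) where
  measurable_fst := h.measurable_field.comp measurable_prodMk_left
  measurable_snd := h.measurable_field.comp measurable_prodMk_left
  gaussian := h.gaussian.hasGaussianLaw_prodMk
  mean_fst := h.mean_zero x
  mean_snd := h.mean_zero y
  cov_fst i j := by simp [h.cov_eq]
  cov_snd i j := by simp [h.cov_eq]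
  cov_cross i j := by
    rw [h.cov_eq]
    by_cases hij : i = j
    · subst hij; simp [corr, sub_eq_zero]
    · simp [hij]

theorem IsLongMemoryField.map_eq (h : IsLongMemoryField P η α L) (x : EuclideanSpace ℝ (Fin d)) :
    P.map (η x) = stdGauss m :=
  (h.isCorrelatedPair x x).measurePreserving_fst.map_eq

theorem IsLongMemoryField.measurable_corr (h : IsLongMemoryField P η α L) (j : Fin m) :
    Measurable fun z : EuclideanSpace ℝ (Fin d) => corr α L z j := by
  unfold corr
  refine Measurable.ite (measurableSet_singleton 0) measurable_const ?_
  exact (measurable_norm.pow_const _).mul ((h.slowlyVarying j).1.comp measurable_norm)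

theorem IsLongMemoryField.abs_corr_le_one (h : IsLongMemoryField P η α L)
    (z : EuclideanSpace ℝ (Fin d)) (j : Fin m) : |corr α L z j| ≤ 1 := by
  simpa using (h.isCorrelatedPair z 0).abs_le_one j

end Field

/-! ### Normalization in `L²` -/

section Normalization

theorem norm_inv_smul_sub_inv_smul_le {H : Type*} [NormedAddCommGroup H] [NormedSpace ℝ H]
    {x y : H} (hx : x ≠ 0) (hy : y ≠ 0) :
    ‖‖x‖⁻¹ • x - ‖y‖⁻¹ • y‖ ≤ 2 * (‖x - y‖ / ‖y‖) := by
  have hx' := norm_pos_iff.2 hx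
  have hy' := norm_pos_iff.2 hy
  have e : ‖x‖⁻¹ • x - ‖y‖⁻¹ • y = (‖x‖⁻¹ - ‖y‖⁻¹) • x + ‖y‖⁻¹ • (x - y) := by
    rw [sub_smul, smul_sub]; abel
  rw [e]
  refine (norm_add_le _ _).trans ?_
  rw [norm_smul, norm_smul, norm_inv, norm_norm, Real.norm_eq_abs]
  have h1 : |‖x‖⁻¹ - ‖y‖⁻¹| * ‖x‖ = |‖y‖ - ‖x‖| / ‖y‖ := by
    rw [inv_sub_inv hx'.ne' hy'.ne', abs_div, abs_of_pos (mul_pos hx' hy')]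
    field_simp
  have h2 : |‖y‖ - ‖x‖| ≤ ‖x - y‖ := by rw [norm_sub_rev]; exact abs_norm_sub_norm_le _ _
  rw [h1]
  have h3 : |‖y‖ - ‖x‖| / ‖y‖ ≤ ‖x - y‖ / ‖y‖ := by gcongr
  have h4 : ‖y‖⁻¹ * ‖x - y‖ = ‖x - y‖ / ‖y‖ := by ring
  linarith

variable {Ω : Type*} [MeasurableSpace Ω] {P : Measure Ω}

theorem norm_toLp_eq_sqrt {f : Ω → ℝ} (hf : MemLp f 2 P) :
    ‖hf.toLp f‖ = √(∫ ω, f ω ^ 2 ∂P) := by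
  have h := inner_toLp_toLp hf hf
  rw [real_inner_self_eq_norm_sq] at h
  simp_rw [← pow_two] at h
  rw [← h, Real.sqrt_sq (norm_nonneg _)]

/-- If `E (X_r - Y_r)² = o(E Y_r²)` then `E X_r²` is eventually positive, and the difference of the
normalized variables tends to `0` in probability. -/
theorem tendstoInMeasure_normalized_sub {X Y : ℝ → Ω → ℝ} (hX : ∀ r, MemLp (X r) 2 P)
    (hY : ∀ r, MemLp (Y r) 2 P) (hpos : ∀ᶠ r in atTop, 0 < ∫ ω, Y r ω ^ 2 ∂P)
    (hlim : Tendsto (fun r => (∫ ω, (X r ω - Y r ω) ^ 2 ∂P) / ∫ ω, Y r ω ^ 2 ∂P) atTop (𝓝 0)) :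
    (∀ᶠ r in atTop, 0 < ∫ ω, X r ω ^ 2 ∂P) ∧
    TendstoInMeasure P (fun r ω => X r ω / √(∫ ω, X r ω ^ 2 ∂P) - Y r ω / √(∫ ω, Y r ω ^ 2 ∂P))
      atTop (fun _ => 0) := by
  set x := fun r => (hX r).toLp (X r) with hxdef
  set y := fun r => (hY r).toLp (Y r) with hydef
  have hnx : ∀ r, ‖x r‖ = √(∫ ω, X r ω ^ 2 ∂P) := fun r => norm_toLp_eq_sqrt (hX r)
  have hny : ∀ r, ‖y r‖ = √(∫ ω, Y r ω ^ 2 ∂P) := fun r => norm_toLp_eq_sqrt (hY r)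
  have hnxy : ∀ r, ‖x r - y r‖ = √(∫ ω, (X r ω - Y r ω) ^ 2 ∂P) := fun r => by
    have := norm_toLp_eq_sqrt ((hX r).sub (hY r))
    rw [MemLp.toLp_sub] at this
    simpa using this
  have hratio : Tendsto (fun r => ‖x r - y r‖ / ‖y r‖) atTop (𝓝 0) := by
    have := hlim.sqrt
    rw [Real.sqrt_zero] at this
    refine this.congr fun r => ?_
    rw [hnxy, hny, Real.sqrt_div (integral_nonneg fun _ => sq_nonneg _)]
  have hy0 : ∀ᶠ r in atTop, 0 < ‖y r‖ := hpos.mono fun r hr => by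
    rw [hny]; exact Real.sqrt_pos.2 hr
  have hx0 : ∀ᶠ r in atTop, 0 < ‖x r‖ := by
    filter_upwards [hy0, hratio.eventually_lt_const one_pos] with r h1 h2
    rw [div_lt_one h1] at h2
    have := norm_sub_norm_le (y r) (x r)
    rw [norm_sub_rev] at this
    linarith
  refine ⟨hx0.mono fun r hr => ?_, ?_⟩
  · rw [hnx] at hr
    exact Real.sqrt_pos.1 hr
  have hlim2 : Tendsto (fun r => ‖x r‖⁻¹ • x r - ‖y r‖⁻¹ • y r) atTop (𝓝 0) := by
    refine squeeze_zero_norm' ?_ (by simpa using hratio.const_mul 2)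
    filter_upwards [hx0, hy0] with r h1 h2
    exact norm_inv_smul_sub_inv_smul_le (norm_pos_iff.1 h1) (norm_pos_iff.1 h2)
  have := tendstoInMeasure_of_tendsto_Lp hlim2
  refine this.congr (fun r => ?_) (Lp.coeFn_zero ℝ 2 P)
  filter_upwards [Lp.coeFn_sub (‖x r‖⁻¹ • x r) (‖y r‖⁻¹ • y r), Lp.coeFn_smul ‖x r‖⁻¹ (x r),
    Lp.coeFn_smul ‖y r‖⁻¹ (y r), (hX r).coeFn_toLp, (hY r).coeFn_toLp] with ω h1 h2 h3 h4 h5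
  rw [h1, Pi.sub_apply, h2, h3, Pi.smul_apply, Pi.smul_apply, h4, h5, hnx, hny]
  simp only [smul_eq_mul]
  ring

end Normalization

/-! ### Double integrals of difference kernels -/

section Kernel

variable {d : ℕ}

/-- The kernel equal to `1` near the origin and to `‖z‖ ^ (-b)` away from it. -/
noncomputable def cutoffPow (T b : ℝ) (z : EuclideanSpace ℝ (Fin d)) : ℝ :=
  if ‖z‖ < T then 1 else ‖z‖ ^ (-b)

theorem measurable_cutoffPow (T b : ℝ) : Measurable (cutoffPow (d := d) T b) := by
  unfold cutoffPow
  exact Measurable.ite (measurableSet_lt measurable_norm measurable_const) measurable_const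
    (measurable_norm.pow_const _)

theorem cutoffPow_nonneg (T b : ℝ) (z : EuclideanSpace ℝ (Fin d)) : 0 ≤ cutoffPow T b z := by
  unfold cutoffPow; split_ifs <;> positivity

theorem cutoffPow_le_one {T b : ℝ} (hT : 1 ≤ T) (hb : 0 ≤ b) (z : EuclideanSpace ℝ (Fin d)) :
    cutoffPow T b z ≤ 1 := by
  unfold cutoffPow
  split_ifs with h
  · exact le_rfl
  · exact Real.rpow_le_one_of_one_le_of_nonpos (hT.trans (not_lt.1 h)) (neg_nonpos.2 hb)

theorem integrableOn_ball_norm_rpow (hd : 0 < d) {b : ℝ} (hb : b < d) (D : ℝ) (hD : 0 < D) :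
    IntegrableOn (fun z : EuclideanSpace ℝ (Fin d) => ‖z‖ ^ (-b)) (Metric.ball 0 D) := by
  have : Nonempty (Fin d) := ⟨⟨0, hd⟩⟩
  rw [integrableOn_fun_norm_addHaar volume (f := fun t : ℝ => t ^ (-b))]
  have h : IntegrableOn (fun y : ℝ => y ^ ((d : ℝ) - 1 - b)) (Set.Ioo 0 D) := by
    rw [intervalIntegral.integrableOn_Ioo_rpow_iff hD]
    linarith
  refine h.congr_fun (fun y hy => ?_) measurableSet_Ioo
  simp only [finrank_euclideanSpace, Fintype.card_fin, smul_eq_mul]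
  rw [← Real.rpow_natCast, ← Real.rpow_add hy.1, Nat.cast_sub hd]
  congr 1
  push_cast
  ring

theorem setIntegral_ball_norm_rpow (b D : ℝ) {r : ℝ} (hr : 0 < r) :
    ∫ z in Metric.ball (0 : EuclideanSpace ℝ (Fin d)) (D * r), ‖z‖ ^ (-b) =
      r ^ ((d : ℝ) - b) * ∫ z in Metric.ball (0 : EuclideanSpace ℝ (Fin d)) D, ‖z‖ ^ (-b) := by
  have h := Measure.setIntegral_comp_smul_of_pos volume
    (fun z : EuclideanSpace ℝ (Fin d) => ‖z‖ ^ (-b)) (Metric.ball 0 D) hr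
  rw [smul_ball hr.ne', smul_zero, Real.norm_of_nonneg hr.le, mul_comm r D] at h
  simp_rw [norm_smul, Real.norm_of_nonneg hr.le, Real.mul_rpow hr.le (norm_nonneg _)] at h
  rw [integral_const_mul, smul_eq_mul, finrank_euclideanSpace, Fintype.card_fin] at h
  have h2 : r ^ ((d : ℝ) - b) = r ^ d * r ^ (-b) := by
    rw [sub_eq_add_neg, Real.rpow_add hr, Real.rpow_natCast]
  rw [h2, mul_assoc, h, mul_inv_cancel_left₀ (pow_pos hr d).ne']

/-- Away from the origin the kernel is at most `T ^ b ‖z‖ ^ (-b)`, which is locally integrable for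
`b < d` and homogeneous, so scaling gives the power of `r`. -/
theorem exists_setIntegral_cutoffPow_le (hd : 0 < d) {T b D : ℝ} (hT : 1 ≤ T) (hb0 : 0 ≤ b)
    (hb : b < d) (hD : 0 < D) :
    ∃ J : ℝ, ∀ r : ℝ, 0 < r →
      ∫ z in Metric.ball (0 : EuclideanSpace ℝ (Fin d)) (D * r), cutoffPow T b z ≤
        J * r ^ ((d : ℝ) - b) := by
  have : Nonempty (Fin d) := ⟨⟨0, hd⟩⟩
  refine ⟨T ^ b * ∫ z in Metric.ball (0 : EuclideanSpace ℝ (Fin d)) D, ‖z‖ ^ (-b), fun r hr => ?_⟩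
  have hle : ∀ z : EuclideanSpace ℝ (Fin d), z ≠ 0 → cutoffPow T b z ≤ T ^ b * ‖z‖ ^ (-b) := by
    intro z hz
    have hz' := norm_pos_iff.2 hz
    unfold cutoffPow
    split_ifs with h
    · rw [Real.rpow_neg hz'.le, ← div_eq_mul_inv, ← Real.div_rpow (by linarith) hz'.le]
      exact Real.one_le_rpow ((one_le_div hz').2 h.le) hb0
    · exact le_mul_of_one_le_left (by positivity) (Real.one_le_rpow hT hb0)
  calc ∫ z in Metric.ball (0 : EuclideanSpace ℝ (Fin d)) (D * r), cutoffPow T b z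
      ≤ ∫ z in Metric.ball (0 : EuclideanSpace ℝ (Fin d)) (D * r), T ^ b * ‖z‖ ^ (-b) := by
        refine integral_mono_of_nonneg (ae_of_all _ fun z => cutoffPow_nonneg _ _ _)
          ((integrableOn_ball_norm_rpow hd hb _ (mul_pos hD hr)).const_mul _) ?_
        refine ae_restrict_of_ae ?_
        filter_upwards [compl_mem_ae_iff.2 (measure_singleton (0 : EuclideanSpace ℝ (Fin d)))]
          with z hz
        exact hle z hz
    _ = _ := by rw [integral_const_mul, setIntegral_ball_norm_rpow b D hr]; ring

variable {A : Set (EuclideanSpace ℝ (Fin d))} {ρ : ℝ}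

theorem setIntegral_comp_sub_le {k : EuclideanSpace ℝ (Fin d) → ℝ} (hk : Measurable k)
    (hk0 : ∀ z, 0 ≤ k z) (hk1 : ∀ z, k z ≤ 1) (hA : A ⊆ Metric.ball 0 ρ)
    {x : EuclideanSpace ℝ (Fin d)} (hx : x ∈ A) :
    ∫ y in A, k (x - y) ≤ ∫ z in Metric.ball 0 (2 * ρ), k z := by
  have hsub : A ⊆ Metric.ball x (2 * ρ) := by
    intro y hy
    have h1 := hA hx
    have h2 := hA hy
    rw [mem_ball_zero_iff] at h1 h2
    rw [Metric.mem_ball, dist_eq_norm]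
    linarith [norm_sub_le y x]
  have hint : IntegrableOn (fun y => k (x - y)) (Metric.ball x (2 * ρ)) :=
    Measure.integrableOn_of_bounded (M := 1) measure_ball_lt_top.ne
      (hk.comp (measurable_const.sub measurable_id)).aestronglyMeasurable
      (ae_of_all _ fun y => by rw [Real.norm_of_nonneg (hk0 _)]; exact hk1 _)
  calc ∫ y in A, k (x - y) ≤ ∫ y in Metric.ball x (2 * ρ), k (x - y) :=
        setIntegral_mono_set hint (ae_of_all _ fun y => hk0 _) hsub.eventuallyLE
    _ = ∫ y, (Metric.ball (0 : EuclideanSpace ℝ (Fin d)) (2 * ρ)).indicator k (x - y) := by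
        rw [← integral_indicator measurableSet_ball]
        refine integral_congr_ae (ae_of_all _ fun y => ?_)
        have hiff : y ∈ Metric.ball x (2 * ρ) ↔ x - y ∈ Metric.ball 0 (2 * ρ) := by
          rw [Metric.mem_ball, mem_ball_zero_iff, dist_eq_norm, norm_sub_rev]
        beta_reduce
        by_cases hy : y ∈ Metric.ball x (2 * ρ)
        · rw [Set.indicator_of_mem hy, Set.indicator_of_mem (hiff.1 hy)]
        · rw [Set.indicator_of_notMem hy, Set.indicator_of_notMem (fun hn => hy (hiff.2 hn))]
    _ = ∫ z in Metric.ball 0 (2 * ρ), k z := by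
        rw [integral_sub_left_eq_self, integral_indicator measurableSet_ball]

theorem integrable_comp_sub {f : EuclideanSpace ℝ (Fin d) → ℝ} (hf : Measurable f)
    (hf1 : ∀ z, |f z| ≤ 1) (μ : Measure (EuclideanSpace ℝ (Fin d) × EuclideanSpace ℝ (Fin d)))
    [IsFiniteMeasure μ] : Integrable (fun q => f (q.1 - q.2)) μ :=
  Integrable.of_bound (hf.comp (measurable_fst.sub measurable_snd)).aestronglyMeasurable 1
    (ae_of_all _ fun _ => hf1 _)

theorem integral_prod_comp_sub_le {k : EuclideanSpace ℝ (Fin d) → ℝ} (hk : Measurable k)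
    (hk0 : ∀ z, 0 ≤ k z) (hk1 : ∀ z, k z ≤ 1) (hA : A ⊆ Metric.ball 0 ρ)
    (hAm : NullMeasurableSet A) [IsFiniteMeasure (volume.restrict A)] :
    ∫ q : EuclideanSpace ℝ (Fin d) × EuclideanSpace ℝ (Fin d), k (q.1 - q.2)
        ∂((volume.restrict A).prod (volume.restrict A)) ≤
      volume.real A * ∫ z in Metric.ball 0 (2 * ρ), k z := by
  have hint := integrable_comp_sub hk (fun z => by rw [abs_of_nonneg (hk0 z)]; exact hk1 z)
    ((volume.restrict A).prod (volume.restrict A))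
  rw [integral_prod _ hint]
  calc ∫ x in A, ∫ y in A, k (x - y) ≤ ∫ _ in A, ∫ z in Metric.ball 0 (2 * ρ), k z := by
        refine integral_mono_ae hint.integral_prod_left (integrable_const _) ?_
        filter_upwards [ae_restrict_mem₀ hAm] with x hx
        exact setIntegral_comp_sub_le hk hk0 hk1 hA hx
    _ = _ := by simp

/-- At distances below `T` the kernel may be negative, but not below `-1`. There `f ≥ -1 ≥ c - 2`,
so for each `x` the loss is at most twice the volume of a ball of radius `T`. -/
theorem le_integral_prod_comp_sub {f : EuclideanSpace ℝ (Fin d) → ℝ} (hf : Measurable f)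
    (hf1 : ∀ z, |f z| ≤ 1) {c T : ℝ} (hc1 : c ≤ 1)
    (hfc : ∀ z, T ≤ ‖z‖ → ‖z‖ ≤ 2 * ρ → c ≤ f z) (hA : A ⊆ Metric.ball 0 ρ)
    (hAm : NullMeasurableSet A) [IsFiniteMeasure (volume.restrict A)] :
    c * volume.real A ^ 2 -
        2 * volume.real A * volume.real (Metric.ball (0 : EuclideanSpace ℝ (Fin d)) T) ≤
      ∫ q : EuclideanSpace ℝ (Fin d) × EuclideanSpace ℝ (Fin d), f (q.1 - q.2)
        ∂((volume.restrict A).prod (volume.restrict A)) := by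
  have hint := integrable_comp_sub hf hf1 ((volume.restrict A).prod (volume.restrict A))
  rw [integral_prod _ hint]
  have key : ∀ x ∈ A, c * volume.real A -
      2 * volume.real (Metric.ball (0 : EuclideanSpace ℝ (Fin d)) T) ≤ ∫ y in A, f (x - y) := by
    intro x hx
    have hball : ∫ y in A, (Metric.ball x T).indicator (fun _ => (1 : ℝ)) y ≤
        volume.real (Metric.ball (0 : EuclideanSpace ℝ (Fin d)) T) := by
      rw [integral_indicator measurableSet_ball, Measure.restrict_restrict measurableSet_ball]
      simp only [integral_const, smul_eq_mul, mul_one, measureReal_restrict_apply_univ]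
      calc volume.real (Metric.ball x T ∩ A) ≤ volume.real (Metric.ball x T) :=
            measureReal_mono Set.inter_subset_left measure_ball_lt_top.ne
        _ = _ := by rw [measureReal_def, measureReal_def, Measure.addHaar_ball_center]
    have hi2 : Integrable (fun y => (Metric.ball x T).indicator (fun _ => (1 : ℝ)) y)
        (volume.restrict A) := (integrable_const 1).indicator measurableSet_ball
    calc c * volume.real A - 2 * volume.real (Metric.ball (0 : EuclideanSpace ℝ (Fin d)) T)
        ≤ c * volume.real A - 2 * ∫ y in A, (Metric.ball x T).indicator (fun _ => (1 : ℝ)) y := by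
          linarith
      _ = ∫ y in A, (c - 2 * (Metric.ball x T).indicator (fun _ => (1 : ℝ)) y) := by
          rw [integral_sub (integrable_const _) (hi2.const_mul _), integral_const_mul]
          simp [mul_comm]
      _ ≤ ∫ y in A, f (x - y) := by
          refine integral_mono_ae ((integrable_const _).sub (hi2.const_mul _))
            (Integrable.of_bound (hf.comp (measurable_const.sub measurable_id)).aestronglyMeasurable
              1 (ae_of_all _ fun y => hf1 _)) ?_
          filter_upwards [ae_restrict_mem₀ hAm] with y hy
          by_cases hyx : y ∈ Metric.ball x T
          · simp only [Set.indicator_of_mem hyx]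
            linarith [(abs_le.1 (hf1 (x - y))).1]
          · simp only [Set.indicator_of_notMem hyx]
            rw [Metric.mem_ball, dist_eq_norm, norm_sub_rev, not_lt] at hyx
            have h1 := hA hx
            have h2 := hA hy
            rw [mem_ball_zero_iff] at h1 h2
            have := hfc (x - y) hyx (by linarith [norm_sub_le x y])
            linarith
  calc c * volume.real A ^ 2 -
        2 * volume.real A * volume.real (Metric.ball (0 : EuclideanSpace ℝ (Fin d)) T)
      = ∫ _ in A, (c * volume.real A -
          2 * volume.real (Metric.ball (0 : EuclideanSpace ℝ (Fin d)) T)) := by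
        simp
        ring
    _ ≤ ∫ x in A, ∫ y in A, f (x - y) := by
        refine integral_mono_ae (integrable_const _) hint.integral_prod_left ?_
        filter_upwards [ae_restrict_mem₀ hAm] with x hx
        exact key x hx

end Kernel

/-! ### Power bounds for slowly varying functions -/

/-- Uniform convergence theorem for additive slow variation. -/
theorem exists_forall_abs_sub_lt_of_tendsto_sub {h : ℝ → ℝ} (hm : Measurable h)
    (hlim : ∀ u, Tendsto (fun x => h (x + u) - h x) atTop (𝓝 0)) {ε : ℝ} (hε : 0 < ε) :
    ∃ X, ∀ x ≥ X, ∀ u ∈ Set.Icc (0 : ℝ) 1, |h (x + u) - h x| < ε := by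
  by_contra! hcon
  choose x hx u hu hbad using fun n : ℕ => hcon n
  have hxlim : Tendsto x atTop atTop :=
    tendsto_atTop_mono hx tendsto_natCast_atTop_atTop
  -- Pointwise convergence makes the tail unions of bad shifts decrease to the empty set, so within
  -- a bounded interval their measure tends to zero.
  have key : ∀ (y : ℕ → ℝ), Tendsto y atTop atTop → ∀ b : ℝ, ∃ N, ∀ n ≥ N,
      volume (Set.Icc 0 b ∩ ⋃ k ≥ n, {w | ε / 2 ≤ |h (y k + w) - h (y k)|}) <
        ENNReal.ofReal (1 / 2) := by
    intro y hy b
    have hbadm : ∀ k, MeasurableSet {w | ε / 2 ≤ |h (y k + w) - h (y k)|} := fun k =>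
      measurableSet_le measurable_const
        (((hm.comp (measurable_const_add _)).sub_const _).abs)
    have ht : Tendsto (fun n => volume (Set.Icc 0 b ∩
        ⋃ k ≥ n, {w | ε / 2 ≤ |h (y k + w) - h (y k)|})) atTop
        (𝓝 (volume (⋂ n, Set.Icc 0 b ∩ ⋃ k ≥ n, {w | ε / 2 ≤ |h (y k + w) - h (y k)|}))) := by
      refine tendsto_measure_iInter_atTop (fun n => ?_) ?_ ⟨0, ?_⟩
      · exact (measurableSet_Icc.inter (MeasurableSet.iUnion fun k =>
          MeasurableSet.iUnion fun _ => hbadm k)).nullMeasurableSet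
      · intro n n' hn
        refine Set.inter_subset_inter_right _ ?_
        exact Set.biUnion_subset_biUnion_left fun k hk => le_trans hn hk
      · exact (measure_mono Set.inter_subset_left).trans_lt (by simp) |>.ne
    have hempty : (⋂ n, Set.Icc 0 b ∩ ⋃ k ≥ n, {w | ε / 2 ≤ |h (y k + w) - h (y k)|}) = ∅ := by
      ext w
      simp only [Set.mem_iInter, Set.mem_inter_iff, Set.mem_iUnion, Set.mem_ofPred_eq,
        Set.mem_empty_iff_false, iff_false, not_forall]
      have h1 := ((hlim w).comp hy).abs
      simp only [abs_zero] at h1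
      obtain ⟨N, hN⟩ := eventually_atTop.1 (h1.eventually_lt_const (half_pos hε))
      refine ⟨N, fun hw => ?_⟩
      obtain ⟨k, hk, hk'⟩ := hw.2
      exact absurd hk' (not_le.2 (hN k hk))
    rw [hempty, measure_empty] at ht
    exact eventually_atTop.1 (ht.eventually_lt_const (by simp))
  obtain ⟨N₁, hN₁⟩ := key x hxlim 2
  obtain ⟨N₂, hN₂⟩ := key (fun n => x n + u n)
    (tendsto_atTop_mono (fun n => le_add_of_nonneg_right (hu n).1) hxlim) 1
  set n := max N₁ N₂
  have h1 := hN₁ n (le_max_left _ _)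
  have h2 := hN₂ n (le_max_right _ _)
  set S₁ := Set.Icc (0 : ℝ) 2 ∩ ⋃ k ≥ n, {w | ε / 2 ≤ |h (x k + w) - h (x k)|}
  set S₂ := Set.Icc (0 : ℝ) 1 ∩
    ⋃ k ≥ n, {w | ε / 2 ≤ |h (x k + u k + w) - h (x k + u k)|}
  -- If `w` were good from `x n + u n` and `u n + w` good from `x n`, comparing both with `h (x n +
  -- u n + w)` would contradict the choice of `u n`. But two sets of measure below `1 / 2` cannot
  -- cover `[0, 1]`. Since `u n + w ≤ 2`, `S₁` lives on `[0, 2]`.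
  have hcov : Set.Icc (0 : ℝ) 1 ⊆ ((fun w => u n + w) ⁻¹' S₁) ∪ S₂ := by
    intro w hw
    by_contra hnot
    simp only [Set.mem_union, not_or] at hnot
    have a1 : |h (x n + (u n + w)) - h (x n)| < ε / 2 := by
      by_contra! hc
      refine hnot.1 ⟨⟨by linarith [(hu n).1, hw.1], by linarith [(hu n).2, hw.2]⟩, ?_⟩
      simp only [Set.mem_iUnion]
      exact ⟨n, le_rfl, hc⟩
    have a2 : |h (x n + u n + w) - h (x n + u n)| < ε / 2 := by
      by_contra! hc
      refine hnot.2 ⟨hw, ?_⟩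
      simp only [Set.mem_iUnion]
      exact ⟨n, le_rfl, hc⟩
    have a3 := hbad n
    rw [← add_assoc] at a1
    rw [abs_lt] at a1 a2
    have : |h (x n + u n) - h (x n)| < ε := abs_lt.2 ⟨by linarith, by linarith⟩
    linarith
  have hvol : (1 : ENNReal) ≤ volume S₁ + volume S₂ := by
    calc (1 : ENNReal) = volume (Set.Icc (0 : ℝ) 1) := by simp
      _ ≤ volume (((fun w => u n + w) ⁻¹' S₁) ∪ S₂) := measure_mono hcov
      _ ≤ volume ((fun w => u n + w) ⁻¹' S₁) + volume S₂ := measure_union_le _ _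
      _ = _ := by rw [measure_preimage_add]
  have : volume S₁ + volume S₂ < ENNReal.ofReal (1 / 2) + ENNReal.ofReal (1 / 2) :=
    ENNReal.add_lt_add h1 h2
  rw [← ENNReal.ofReal_add (by norm_num) (by norm_num)] at this
  norm_num at this
  exact absurd hvol (not_le.2 this)

/-- Far out, each step of length at most one changes `h` by less than `ε / 2`. Summing steps gives
growth of slope `ε / 2`, and the other half absorbs the initial value. -/
theorem exists_forall_abs_le_of_tendsto_sub {h : ℝ → ℝ} (hm : Measurable h)
    (hlim : ∀ u, Tendsto (fun x => h (x + u) - h x) atTop (𝓝 0)) {ε : ℝ} (hε : 0 < ε) :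
    ∀ᶠ x in atTop, |h x| ≤ ε * x := by
  obtain ⟨X, hX⟩ := exists_forall_abs_sub_lt_of_tendsto_sub hm hlim (half_pos hε)
  have hnat : ∀ n : ℕ, ∀ u ∈ Set.Icc (0 : ℝ) 1, |h (X + n + u) - h X| ≤ ε / 2 * (n + 1) := by
    intro n
    induction n with
    | zero => intro u hu; simpa using (hX X le_rfl u hu).le
    | succ n ih =>
      intro u hu
      have h1 := hX (X + (n + 1)) (by linarith [(n.cast_nonneg : (0 : ℝ) ≤ n)]) u hu
      have h2 := ih 1 (by simp)
      rw [add_assoc X] at h2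
      push_cast
      calc |h (X + (n + 1) + u) - h X| ≤
          |h (X + (n + 1) + u) - h (X + (n + 1))| + |h (X + (n + 1)) - h X| := abs_sub_le _ _ _
        _ ≤ _ := by linarith
  have hbig : ∀ᶠ x in atTop, |h X| + ε / 2 * (x - X + 1) ≤ ε * x := by
    filter_upwards [eventually_ge_atTop ((|h X| + ε / 2 * (1 - X)) / (ε / 2))] with x hx
    rw [div_le_iff₀ (half_pos hε)] at hx
    linarith
  filter_upwards [eventually_ge_atTop X, hbig] with x hx hx2
  have h0 : 0 ≤ x - X := sub_nonneg.2 hx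
  have h1 := hnat ⌊x - X⌋₊ (x - X - ⌊x - X⌋₊)
    ⟨sub_nonneg.2 (Nat.floor_le h0), by linarith [Nat.lt_floor_add_one (x - X)]⟩
  rw [show X + (⌊x - X⌋₊ : ℝ) + (x - X - ⌊x - X⌋₊) = x by ring] at h1
  have h2 := Nat.floor_le h0
  have h3 : ε / 2 * ((⌊x - X⌋₊ : ℝ) + 1) ≤ ε / 2 * (x - X + 1) := by gcongr
  have h4 : |h x| ≤ |h x - h X| + |h X| := by simpa using abs_sub_le (h x) (h X) 0
  linarith

/-- A slowly varying function is eventually between `t ^ (-ε)` and `t ^ ε`. -/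
theorem SlowlyVarying.eventually_rpow_bounds {L : ℝ → ℝ} (hL : SlowlyVarying L) {ε : ℝ}
    (hε : 0 < ε) : ∀ᶠ t in atTop, t ^ (-ε) ≤ L t ∧ L t ≤ t ^ ε := by
  obtain ⟨hm, hpos, hlim⟩ := hL
  -- Substituting `t = exp x` and taking logarithms makes slow variation additive; `L` need be
  -- positive only for large arguments.
  have h := exists_forall_abs_le_of_tendsto_sub (h := fun x => Real.log (L (Real.exp x)))
    (Real.measurable_log.comp (hm.comp Real.measurable_exp)) (fun u => ?_) hε
  · filter_upwards [Real.tendsto_log_atTop.eventually h, hpos, eventually_gt_atTop 0]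
      with t ht hLt ht0
    rw [Real.exp_log ht0, abs_le] at ht
    rw [Real.rpow_def_of_pos ht0, Real.rpow_def_of_pos ht0, ← Real.le_log_iff_exp_le hLt,
      ← Real.log_le_iff_le_exp hLt]
    exact ⟨by linarith, by linarith⟩
  · have h1 := (hlim (Real.exp u) (Real.exp_pos u)).comp Real.tendsto_exp_atTop
    have h2 := (Real.continuousAt_log one_ne_zero).tendsto.comp h1
    rw [Real.log_one] at h2
    refine h2.congr' ?_
    filter_upwards [Real.tendsto_exp_atTop.eventually hpos,
      (tendsto_atTop_add_const_right atTop u tendsto_id).eventually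
        (Real.tendsto_exp_atTop.eventually hpos)] with x hx hxu
    simp only [id] at hxu
    simp only [Function.comp_apply]
    rw [← Real.exp_add, add_comm u x, Real.log_div hxu.ne' hx.ne']

/-! ### Variance bounds over growing domains -/

section Asymptotics

variable {Ω : Type*} [MeasurableSpace Ω] {P : Measure Ω} {d m : ℕ}
  {η : EuclideanSpace ℝ (Fin d) → Ω → (Fin m → ℝ)} {α : Fin m → ℝ} {L : Fin m → ℝ → ℝ}

theorem IsLongMemoryField.exists_abs_corr_le (h : IsLongMemoryField P η α L) {a : ℝ}
    (ha : ∀ j, a < α j) :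
    ∃ T, 1 ≤ T ∧ ∀ (z : EuclideanSpace ℝ (Fin d)) (j : Fin m), T ≤ ‖z‖ →
      |corr α L z j| ≤ ‖z‖ ^ (-a) := by
  have hev : ∀ᶠ t : ℝ in atTop, ∀ j, t ^ (-(α j - a)) ≤ L j t ∧ L j t ≤ t ^ (α j - a) :=
    eventually_all.2 fun j => (h.slowlyVarying j).eventually_rpow_bounds (sub_pos.2 (ha j))
  obtain ⟨T, hT⟩ := eventually_atTop.1 hev
  refine ⟨max T 1, le_max_right _ _, fun z j hz => ?_⟩
  have hz1 : 1 ≤ ‖z‖ := (le_max_right _ _).trans hz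
  have hz0 : 0 < ‖z‖ := by linarith
  obtain ⟨h1, h2⟩ := hT ‖z‖ ((le_max_left _ _).trans hz) j
  have hL : 0 ≤ L j ‖z‖ := (Real.rpow_nonneg hz0.le _).trans h1
  rw [corr, if_neg (norm_pos_iff.1 hz0), abs_of_nonneg (by positivity)]
  calc ‖z‖ ^ (-α j) * L j ‖z‖ ≤ ‖z‖ ^ (-α j) * ‖z‖ ^ (α j - a) := by gcongr
    _ = ‖z‖ ^ (-a) := by rw [← Real.rpow_add hz0]; congr 1; ring

theorem IsLongMemoryField.exists_le_prod_corr (h : IsLongMemoryField P η α L) (v : Fin m → ℕ)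
    {b : ℝ} (hb : ∑ j, α j * v j < b) :
    ∃ T, 1 ≤ T ∧ ∀ z : EuclideanSpace ℝ (Fin d), T ≤ ‖z‖ →
      ‖z‖ ^ (-b) ≤ ∏ j, corr α L z j ^ v j := by
  set N : ℝ := ∑ j, (v j : ℝ)
  have hN : 0 ≤ N := Finset.sum_nonneg fun _ _ => Nat.cast_nonneg _
  -- The slack is shared among the `N` factors; the extra `1` keeps the denominator positive when `v
  -- = 0`.
  set ε : ℝ := (b - ∑ j, α j * v j) / (N + 1) with hε
  have hε0 : 0 < ε := div_pos (sub_pos.2 hb) (by linarith)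
  have hεN : ε * (N + 1) = b - ∑ j, α j * v j := div_mul_cancel₀ _ (by linarith)
  have hev : ∀ᶠ t : ℝ in atTop, ∀ j, t ^ (-ε) ≤ L j t ∧ L j t ≤ t ^ ε :=
    eventually_all.2 fun j => (h.slowlyVarying j).eventually_rpow_bounds hε0
  obtain ⟨T, hT⟩ := eventually_atTop.1 hev
  refine ⟨max T 1, le_max_right _ _, fun z hz => ?_⟩
  have hz1 : 1 ≤ ‖z‖ := (le_max_right _ _).trans hz
  have hz0 : 0 < ‖z‖ := by linarith
  calc ‖z‖ ^ (-b) ≤ ‖z‖ ^ (∑ j, (-(α j + ε)) * v j) := by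
        refine Real.rpow_le_rpow_of_exponent_le hz1 ?_
        have : ∑ j, (-(α j + ε)) * (v j : ℝ) = -(∑ j, α j * v j) - ε * N := by
          rw [Finset.mul_sum, ← Finset.sum_neg_distrib, ← Finset.sum_sub_distrib]
          exact Finset.sum_congr rfl fun j _ => by ring
        rw [this]
        linarith
    _ = ∏ j, (‖z‖ ^ (-(α j + ε))) ^ v j := by
        rw [Real.rpow_sum_of_pos hz0]
        refine Finset.prod_congr rfl fun j _ => ?_
        rw [Real.rpow_mul hz0.le, Real.rpow_natCast]
    _ ≤ ∏ j, corr α L z j ^ v j := by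
        refine Finset.prod_le_prod (fun j _ => by positivity) fun j _ => ?_
        refine pow_le_pow_left₀ (by positivity) ?_ _
        rw [corr, if_neg (norm_pos_iff.1 hz0), neg_add, Real.rpow_add hz0]
        have := (hT ‖z‖ ((le_max_left _ _).trans hz) j).1
        gcongr

variable {Δ : Set (EuclideanSpace ℝ (Fin d))}

theorem exists_smul_subset_ball (hΔ : Bornology.IsBounded Δ) :
    ∃ D : ℝ, 0 < D ∧ ∀ r : ℝ, 0 < r → r • Δ ⊆ Metric.ball 0 (D * r) := by
  obtain ⟨D, hD0, hD⟩ := hΔ.subset_ball_lt 0 0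
  refine ⟨D, hD0, fun r hr => ?_⟩
  have := Set.smul_set_mono (a := r) hD
  rwa [smul_ball hr.ne', smul_zero, Real.norm_of_nonneg hr.le, mul_comm] at this

theorem measureReal_smul_of_pos (r : ℝ) (hr : 0 < r) :
    volume.real (r • Δ) = r ^ (d : ℝ) * volume.real Δ := by
  rw [measureReal_def, Measure.addHaar_smul_of_nonneg _ hr.le, ENNReal.toReal_mul,
    ENNReal.toReal_ofReal (by positivity), finrank_euclideanSpace, Fintype.card_fin,
    Real.rpow_natCast, measureReal_def]

theorem isFiniteMeasure_restrict_smul (hΔ : Bornology.IsBounded Δ) (r : ℝ) :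
    IsFiniteMeasure (volume.restrict (r • Δ)) :=
  isFiniteMeasure_restrict.2 (hΔ.smul₀ r).measure_lt_top.ne

/-- The variance of the integral over `r • Δ` of a function without Hermite coefficients of degree
at most `n` is of order at most `r ^ (2 d - b)`, for every `b` below `d` and `(n + 1) min α`. -/
theorem IsLongMemoryField.exists_integral_sq_le [IsProbabilityMeasure P]
    (h : IsLongMemoryField P η α L) (hd : 0 < d) (hc : Convex ℝ Δ) (hΔ : Bornology.IsBounded Δ)
    {F : (Fin m → ℝ) → ℝ} (hF : MemLp F 2 (stdGauss m)) {n : ℕ}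
    (hn : ∀ v, ∑ j, v j ≤ n → hermiteCoeff F v = 0) {b : ℝ} (hb0 : 0 ≤ b) (hbd : b < d)
    (hb : ∀ j, b < (n + 1) * α j) :
    ∃ C, ∀ r : ℝ, 0 < r →
      ∫ ω, (∫ x in r • Δ, F (η x ω)) ^ 2 ∂P ≤ C * (r ^ (d : ℝ) * r ^ ((d : ℝ) - b)) := by
  have hn0 : (0 : ℝ) < n + 1 := by positivity
  -- Correlations decay at least with exponent `b / (n + 1)`, and the correlations of `F` carry
  -- their `(n + 1)`-st power, hence exponent `b`.
  obtain ⟨T, hT1, hT⟩ := h.exists_abs_corr_le (a := b / (n + 1))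
    fun j => by rw [div_lt_iff₀ hn0, mul_comm]; exact hb j
  obtain ⟨D, hD0, hD⟩ := exists_smul_subset_ball hΔ
  obtain ⟨J, hJ⟩ := exists_setIntegral_cutoffPow_le hd hT1 hb0 hbd
    (show (0 : ℝ) < 2 * D by positivity)
  set M := ∫ x, F x ^ 2 ∂(stdGauss m)
  have hM : 0 ≤ M := integral_nonneg fun _ => sq_nonneg _
  refine ⟨M * (volume.real Δ * J), fun r hr => ?_⟩
  have := isFiniteMeasure_restrict_smul hΔ r
  -- Convexity stands in for measurability: a convex set differs from a Borel set by a null set.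
  have hnull : NullMeasurableSet (r • Δ) := (hc.smul r).nullMeasurableSet volume
  have hpt : ∀ x y, ∫ ω, F (η x ω) * F (η y ω) ∂P ≤ M * cutoffPow T b (x - y) := by
    intro x y
    have hR := (h.isCorrelatedPair x y).abs_integral_le hF hn
      (cutoffPow_nonneg T (b / (n + 1)) (x - y))
      (cutoffPow_le_one hT1 (by positivity) (x - y)) fun j => by
        unfold cutoffPow
        split_ifs with hz
        · exact h.abs_corr_le_one _ j
        · exact hT _ j (not_lt.1 hz)
    have hpow : cutoffPow T (b / (n + 1)) (x - y) ^ (n + 1) = cutoffPow T b (x - y) := by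
      unfold cutoffPow
      split_ifs with hz
      · simp
      · rw [← Real.rpow_natCast, ← Real.rpow_mul (norm_nonneg _)]
        congr 1
        push_cast
        field_simp
    rw [hpow, mul_comm] at hR
    exact (le_abs_self _).trans hR
  rw [integral_sq_integral_comp h.measurable_field h.map_eq _ hF]
  calc ∫ q, ∫ ω, F (η q.1 ω) * F (η q.2 ω) ∂P
        ∂((volume.restrict (r • Δ)).prod (volume.restrict (r • Δ)))
      ≤ ∫ q : EuclideanSpace ℝ (Fin d) × EuclideanSpace ℝ (Fin d),
          M * cutoffPow T b (q.1 - q.2)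
          ∂((volume.restrict (r • Δ)).prod (volume.restrict (r • Δ))) := by
        refine integral_mono (integrable_integral_mul h.measurable_field h.map_eq _ hF)
          ((integrable_comp_sub (measurable_cutoffPow T b) (fun z => ?_) _).const_mul _)
          fun q => hpt q.1 q.2
        rw [abs_of_nonneg (cutoffPow_nonneg _ _ _)]
        exact cutoffPow_le_one hT1 hb0 z
    _ ≤ M * (volume.real (r • Δ) * ∫ z in Metric.ball 0 (2 * (D * r)), cutoffPow T b z) := by
        rw [integral_const_mul]
        gcongr
        exact integral_prod_comp_sub_le (measurable_cutoffPow T b) (cutoffPow_nonneg T b)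
          (cutoffPow_le_one hT1 hb0) (hD r hr) hnull
    _ ≤ M * ((r ^ (d : ℝ) * volume.real Δ) * (J * r ^ ((d : ℝ) - b))) := by
        rw [measureReal_smul_of_pos r hr, ← mul_assoc 2 D r]
        gcongr
        exact hJ r hr
    _ = _ := by ring

/-- The variance of the integral over `r • Δ` of `e_v` is of order at least `r ^ (2 d - b)`, for
every `b < d` above `∑ α_j v_j`. -/
theorem IsLongMemoryField.exists_le_integral_sq_hermiteProd [IsProbabilityMeasure P]
    (h : IsLongMemoryField P η α L) (hc : Convex ℝ Δ) (hΔ : Bornology.IsBounded Δ)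
    (h0 : (0 : EuclideanSpace ℝ (Fin d)) ∈ interior Δ) (v : Fin m → ℕ) {b : ℝ}
    (hb : ∑ j, α j * v j < b) (hbd : b < d) :
    ∃ c, 0 < c ∧ ∀ᶠ r : ℝ in atTop, c * (r ^ (d : ℝ) * r ^ ((d : ℝ) - b)) ≤
      ∫ ω, (∫ x in r • Δ, hermiteProd v (η x ω)) ^ 2 ∂P := by
  have hb0 : 0 < b := lt_of_le_of_lt (Finset.sum_nonneg fun j _ =>
    mul_nonneg (h.exponent_pos j).le (Nat.cast_nonneg _)) hb
  obtain ⟨T, hT1, hT⟩ := h.exists_le_prod_corr v hb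
  obtain ⟨D, hD0, hD⟩ := exists_smul_subset_ball hΔ
  set V := volume.real Δ with hVdef
  have hV : 0 < V := by
    rw [hVdef, measureReal_def]
    refine ENNReal.toReal_pos ?_ hΔ.measure_lt_top.ne
    exact (Measure.measure_pos_of_mem_nhds volume (mem_interior_iff_mem_nhds.1 h0)).ne'
  set B := volume.real (Metric.ball (0 : EuclideanSpace ℝ (Fin d)) T)
  have hfac := prod_factorial_pos v
  set N : ℝ := ((∏ j, (v j).factorial : ℕ) : ℝ) with hN
  set c₀ := (2 * D) ^ (-b) * V ^ 2 with hc₀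
  have hc₀' : 0 < c₀ := by positivity
  refine ⟨N * (c₀ / 2), by positivity, ?_⟩
  -- The loss from nearby points is of order `r ^ d`. As `b < d`, it is eventually at most half of
  -- the main term `c₀ r ^ (2d - b)`.
  have hgrow : Tendsto (fun r : ℝ => r ^ ((d : ℝ) - b)) atTop atTop :=
    tendsto_rpow_atTop (sub_pos.2 hbd)
  filter_upwards [hgrow.eventually_ge_atTop (2 * V * B / (c₀ / 2)), eventually_gt_atTop 0,
    eventually_ge_atTop (1 / (2 * D))] with r hr1 hr hr2
  rw [div_le_iff₀ (half_pos hc₀')] at hr1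
  rw [div_le_iff₀ (by positivity)] at hr2
  have := isFiniteMeasure_restrict_smul hΔ r
  have hnull : NullMeasurableSet (r • Δ) := (hc.smul r).nullMeasurableSet volume
  have hmeas : Measurable fun z : EuclideanSpace ℝ (Fin d) => ∏ j, corr α L z j ^ v j :=
    Finset.measurable_fun_prod _ fun j _ => (h.measurable_corr j).pow_const _
  have hbd1 : ∀ z : EuclideanSpace ℝ (Fin d), |∏ j, corr α L z j ^ v j| ≤ 1 := fun z => by
    rw [Finset.abs_prod]
    refine Finset.prod_le_one (fun _ _ => abs_nonneg _) fun j _ => ?_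
    rw [abs_pow]
    exact pow_le_one₀ (abs_nonneg _) (h.abs_corr_le_one z j)
  have hlow := le_integral_prod_comp_sub hmeas hbd1 (c := (2 * (D * r)) ^ (-b)) (T := T)
    (Real.rpow_le_one_of_one_le_of_nonpos (by linarith) (by linarith))
    (fun z hz1 hz2 => by
      refine le_trans ?_ (hT z hz1)
      exact Real.rpow_le_rpow_of_nonpos (by linarith) hz2 (by linarith)) (hD r hr) hnull
  rw [integral_sq_integral_comp h.measurable_field h.map_eq _ (memLp_hermiteProd v)]
  have hpt : ∀ x y, ∫ ω, hermiteProd v (η x ω) * hermiteProd v (η y ω) ∂P =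
      N * ∏ j, corr α L (x - y) j ^ v j := by
    intro x y
    rw [(h.isCorrelatedPair x y).integral_hermiteProd, if_pos rfl, Finset.prod_mul_distrib, hN]
    push_cast
    rfl
  simp_rw [hpt]
  rw [integral_const_mul, mul_assoc]
  refine mul_le_mul_of_nonneg_left (le_trans ?_ hlow) hfac.le
  rw [measureReal_smul_of_pos r hr, ← mul_assoc 2 D r, Real.mul_rpow (by positivity) hr.le,
    sub_eq_add_neg, Real.rpow_add hr]
  rw [sub_eq_add_neg, Real.rpow_add hr] at hr1
  have hrd : 0 < r ^ (d : ℝ) := by positivity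
  have e : (2 * D) ^ (-b) * r ^ (-b) * (r ^ (d : ℝ) * V) ^ 2 - 2 * (r ^ (d : ℝ) * V) * B =
      c₀ * (r ^ (d : ℝ) * (r ^ (d : ℝ) * r ^ (-b))) - r ^ (d : ℝ) * (2 * V * B) := by
    rw [hc₀]; ring
  rw [e]
  have := mul_le_mul_of_nonneg_left hr1 hrd.le
  linarith

end Asymptotics

/-! ### Projection onto finitely many Hermite products -/

section Projection

variable {m : ℕ}

/-- The projection `∑_{v ∈ S} C_v / v! e_v` of `G` onto the span of finitely many Hermite
products. -/
noncomputable def hermiteProj (G : (Fin m → ℝ) → ℝ) (S : Finset (Fin m → ℕ)) (w : Fin m → ℝ) : ℝ :=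
  ∑ v ∈ S, hermiteCoeff G v / (∏ j, (v j).factorial : ℕ) * hermiteProd v w

theorem memLp_hermiteProj (G : (Fin m → ℝ) → ℝ) (S : Finset (Fin m → ℕ)) :
    MemLp (hermiteProj G S) 2 (stdGauss m) :=
  memLp_finsetSum _ fun v _ => (memLp_hermiteProd v).const_mul _

theorem hermiteCoeff_hermiteProj (G : (Fin m → ℝ) → ℝ) (S : Finset (Fin m → ℕ)) (w : Fin m → ℕ) :
    hermiteCoeff (hermiteProj G S) w = if w ∈ S then hermiteCoeff G w else 0 := by
  have hint : ∀ v, Integrable (fun x => hermiteProd v x * hermiteProd w x) (stdGauss m) :=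
    fun v => (memLp_hermiteProd v).integrable_mul (memLp_hermiteProd w)
  rw [hermiteCoeff]
  simp_rw [hermiteProj, Finset.sum_mul, mul_assoc]
  rw [integral_finsetSum _ fun v _ => (hint v).const_mul _]
  simp_rw [integral_const_mul, integral_hermiteProd_mul_hermiteProd]
  simp only [mul_ite, mul_zero, Finset.sum_ite_eq']
  rw [div_mul_cancel₀ _ (prod_factorial_pos w).ne']

theorem hermiteCoeff_sub {F G : (Fin m → ℝ) → ℝ} (hF : MemLp F 2 (stdGauss m))
    (hG : MemLp G 2 (stdGauss m)) (v : Fin m → ℕ) :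
    hermiteCoeff (fun w => F w - G w) v = hermiteCoeff F v - hermiteCoeff G v := by
  unfold hermiteCoeff
  simp_rw [sub_mul]
  exact integral_sub (hF.integrable_mul (memLp_hermiteProd v))
    (hG.integrable_mul (memLp_hermiteProd v))

theorem hermiteProd_zero (w : Fin m → ℝ) : hermiteProd 0 w = 1 := by simp [hermiteProd]

theorem integral_eq_hermiteCoeff_zero (F : (Fin m → ℝ) → ℝ) :
    ∫ w, F w ∂(stdGauss m) = hermiteCoeff F 0 := by
  simp [hermiteCoeff, hermiteProd_zero]

variable {Ω : Type*} [MeasurableSpace Ω] {P : Measure Ω} {d : ℕ}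
  {η : EuclideanSpace ℝ (Fin d) → Ω → (Fin m → ℝ)} {α : Fin m → ℝ} {L : Fin m → ℝ → ℝ}

theorem IsLongMemoryField.integral_hermiteProj_mul (h : IsLongMemoryField P η α L)
    (G : (Fin m → ℝ) → ℝ) (S : Finset (Fin m → ℕ)) (x y : EuclideanSpace ℝ (Fin d)) :
    ∫ ω, hermiteProj G S (η x ω) * hermiteProj G S (η y ω) ∂P =
      ∑ v ∈ S, (hermiteCoeff G v / (∏ j, (v j).factorial : ℕ)) ^ 2 *
        ∫ ω, hermiteProd v (η x ω) * hermiteProd v (η y ω) ∂P := by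
  have h1 := (h.isCorrelatedPair x y).hasSum_integral (memLp_hermiteProj G S)
  have h2 := hasSum_sum_of_ne_finset_zero (L := .unconditional _) (s := S) (f := fun v : Fin m → ℕ =>
    hermiteCoeff (hermiteProj G S) v ^ 2 / (∏ j, (v j).factorial : ℕ) *
      ∏ j, corr α L (x - y) j ^ v j) fun v hv => by simp [hermiteCoeff_hermiteProj, hv]
  rw [h1.unique h2]
  refine Finset.sum_congr rfl fun v hv => ?_
  rw [(h.isCorrelatedPair x y).integral_hermiteProd, if_pos rfl, Finset.prod_mul_distrib,
    hermiteCoeff_hermiteProj, if_pos hv]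
  have := (prod_factorial_pos v).ne'
  push_cast at this ⊢
  field_simp

/-- Cross terms vanish, so the second moment is a sum over `S`. Each summand is itself a multiple of
a second moment, hence nonnegative even where correlations are negative, and all but one may be
dropped. -/
theorem IsLongMemoryField.le_integral_sq_hermiteProj [IsProbabilityMeasure P]
    (h : IsLongMemoryField P η α L) (G : (Fin m → ℝ) → ℝ) {S : Finset (Fin m → ℕ)}
    {v : Fin m → ℕ} (hv : v ∈ S) (μ : Measure (EuclideanSpace ℝ (Fin d))) [IsFiniteMeasure μ] :
    (hermiteCoeff G v / (∏ j, (v j).factorial : ℕ)) ^ 2 *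
        ∫ ω, (∫ x, hermiteProd v (η x ω) ∂μ) ^ 2 ∂P ≤
      ∫ ω, (∫ x, hermiteProj G S (η x ω) ∂μ) ^ 2 ∂P := by
  rw [integral_sq_integral_comp h.measurable_field h.map_eq μ (memLp_hermiteProj G S)]
  simp_rw [h.integral_hermiteProj_mul]
  rw [integral_finsetSum _ fun w _ => (integrable_integral_mul h.measurable_field h.map_eq μ
    (memLp_hermiteProd w)).const_mul _]
  simp_rw [integral_const_mul, ← integral_sq_integral_comp h.measurable_field h.map_eq μ
    (memLp_hermiteProd _)]
  exact Finset.single_le_sum (f := fun v : Fin m → ℕ =>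
    (hermiteCoeff G v / (∏ j, (v j).factorial : ℕ)) ^ 2 *
        ∫ ω, (∫ x, hermiteProd v (η x ω) ∂μ) ^ 2 ∂P)
    (fun w _ => mul_nonneg (sq_nonneg _) (integral_nonneg fun _ => sq_nonneg _)) hv

/-- Sum and integral are interchanged only for those `ω` along which every Hermite product is
integrable, hence the equality is almost sure. -/
theorem IsLongMemoryField.hermiteProjIntegral_ae_eq [IsProbabilityMeasure P]
    (h : IsLongMemoryField P η α L) {Δ : Set (EuclideanSpace ℝ (Fin d))}
    (hΔ : Bornology.IsBounded Δ) (G : (Fin m → ℝ) → ℝ) (κ : ℕ) (r : ℝ) :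
    hermiteProjIntegral η Δ G κ r =ᵐ[P] fun ω =>
      ∫ x in r • Δ, hermiteProj G (Finset.piAntidiag Finset.univ κ) (η x ω) := by
  have := isFiniteMeasure_restrict_smul hΔ r
  have hall : ∀ᵐ ω ∂P, ∀ v : Fin m → ℕ,
      Integrable (fun x => hermiteProd v (η x ω)) (volume.restrict (r • Δ)) :=
    ae_all_iff.2 fun v => ae_integrable_comp h.measurable_field h.map_eq _ (memLp_hermiteProd v)
  filter_upwards [hall] with ω hω
  simp_rw [hermiteProj]
  rw [integral_finsetSum _ fun v _ => (hω v).const_mul _]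
  simp_rw [integral_const_mul]
  rfl

end Projection

/-! ### The reduction theorem -/

theorem theorem2 {Ω : Type*} [MeasurableSpace Ω] (P : Measure Ω) [IsProbabilityMeasure P]
    (d m : ℕ) (η : EuclideanSpace ℝ (Fin d) → Ω → (Fin m → ℝ))
    (α : Fin m → ℝ) (L : Fin m → ℝ → ℝ) (hη : IsLongMemoryField P η α L)
    (Δ : Set (EuclideanSpace ℝ (Fin d))) (hΔ_convex : Convex ℝ Δ)
    (hΔ_bounded : Bornology.IsBounded Δ) (hΔ_zero : (0 : EuclideanSpace ℝ (Fin d)) ∈ interior Δ)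
    (G : (Fin m → ℝ) → ℝ) (hG : MemLp G 2 (stdGauss m))
    (κ : ℕ) (hκ : IsHermiteRank G κ)
    (hα : ∃ v : Fin m → ℕ, ∑ j, v j = κ ∧ hermiteCoeff G v ≠ 0 ∧
      ∑ j, α j * v j < (κ + 1) * ⨅ j, α j ∧ ∑ j, α j * v j < d) :
    -- both random variables are well defined and have finite variance, positive for large `r`
    (∀ r : ℝ, ∀ᵐ ω ∂P, IntegrableOn (fun x => G (η x ω)) (r • Δ)) ∧
    (∀ r : ℝ, ∀ v : Fin m → ℕ, ∀ᵐ ω ∂P, IntegrableOn (fun x => hermiteProd v (η x ω)) (r • Δ)) ∧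
    (∀ r : ℝ, MemLp (fieldIntegral η Δ G r) 2 P ∧ MemLp (hermiteProjIntegral η Δ G κ r) 2 P) ∧
    (∀ᶠ r in atTop, 0 < Var[fieldIntegral η Δ G r; P] ∧
      0 < Var[hermiteProjIntegral η Δ G κ r; P]) ∧
    -- the remainder is negligible
    Tendsto (fun r => Var[fieldIntegral η Δ G r - hermiteProjIntegral η Δ G κ r; P] /
      Var[hermiteProjIntegral η Δ G κ r; P]) atTop (𝓝 0) ∧
    -- if one of the normalized variables has a limit distribution, so has the other, the same one
    ∀ (ν : Measure ℝ) [IsProbabilityMeasure ν],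
      TendstoInDistribution
        (fun (r : ℝ) ω => (fieldIntegral η Δ G r ω - ∫ ω', fieldIntegral η Δ G r ω' ∂P) /
          √(Var[fieldIntegral η Δ G r; P])) atTop (id : ℝ → ℝ) (fun _ => P) ν ↔
      TendstoInDistribution
        (fun (r : ℝ) ω => hermiteProjIntegral η Δ G κ r ω /
          √(Var[hermiteProjIntegral η Δ G κ r; P])) atTop (id : ℝ → ℝ) (fun _ => P) ν := by

  obtain ⟨hκ1, hκ0, -⟩ := hκ
  obtain ⟨v₀, hv₀κ, hv₀C, hv₀1, hv₀d⟩ := hα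
  have hβ0 : 0 ≤ ∑ j, α j * v₀ j := Finset.sum_nonneg fun j _ =>
    mul_nonneg (hη.exponent_pos j).le (Nat.cast_nonneg _)
  have hd : 0 < d := by exact_mod_cast hβ0.trans_lt hv₀d
  set β := ∑ j, α j * (v₀ j : ℝ)
  -- Two exponents strictly above `β`: the lower variance bound takes the smaller and the remainder
  -- bound the larger, and the gap between them forces the ratio to zero. The one named `b₂` is the
  -- smaller in the next line's interval before it is compared with `b₁`.
  obtain ⟨b₁, hb₁, hb₁'⟩ := exists_between (lt_min hv₀1 hv₀d)
  obtain ⟨b₂, hb₂, hb₂'⟩ := exists_between hb₁'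
  have hb₂d : b₂ < d := hb₂'.trans_le (min_le_right _ _)
  have hb₂α : ∀ j, b₂ < (κ + 1) * α j := fun j =>
    (hb₂'.trans_le (min_le_left _ _)).trans_le (mul_le_mul_of_nonneg_left
      (ciInf_le (Set.finite_range α).bddBelow j) (by positivity))
  have hfin := isFiniteMeasure_restrict_smul hΔ_bounded
  have hfm := hη.measurable_field
  have hlaw := hη.map_eq
  set S : Finset (Fin m → ℕ) := Finset.piAntidiag Finset.univ κ with hS
  have hmemS : ∀ v : Fin m → ℕ, v ∈ S ↔ ∑ j, v j = κ := fun v => by simp [hS]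
  set K := fieldIntegral η Δ G
  set Kκ := hermiteProjIntegral η Δ G κ
  set I : ℝ → Ω → ℝ := fun r ω => ∫ x in r • Δ, hermiteProj G S (η x ω) with hI
  have hKκI : ∀ r, Kκ r =ᵐ[P] I r := hη.hermiteProjIntegral_ae_eq hΔ_bounded G κ
  have hKL : ∀ r, MemLp (K r) 2 P := fun r => memLp_two_integral_comp hfm hlaw _ hG
  have hIL : ∀ r, MemLp (I r) 2 P := fun r =>
    memLp_two_integral_comp hfm hlaw _ (memLp_hermiteProj G S)
  have hKκL : ∀ r, MemLp (Kκ r) 2 P := fun r => (hIL r).ae_eq (hKκI r).symm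
  -- the remainder
  set C₀ := hermiteCoeff G 0
  set F : (Fin m → ℝ) → ℝ := fun w => (G w - hermiteProj G S w) - hermiteProj G {0} w with hF
  have hGS : MemLp (fun w => G w - hermiteProj G S w) 2 (stdGauss m) :=
    hG.sub (memLp_hermiteProj G S)
  have hF2 : MemLp F 2 (stdGauss m) := hGS.sub (memLp_hermiteProj G {0})
  have hFC : ∀ v, ∑ j, v j ≤ κ → hermiteCoeff F v = 0 := by
    intro v hv
    rw [hF, hermiteCoeff_sub hGS (memLp_hermiteProj G {0}),
      hermiteCoeff_sub hG (memLp_hermiteProj G S), hermiteCoeff_hermiteProj,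
      hermiteCoeff_hermiteProj]
    by_cases hv0 : v = 0
    -- Since `κ ≥ 1`, the constant term is not among those of degree `κ`, so it is subtracted
    -- exactly once.
    · have h0S : v ∉ S := by rw [hmemS, hv0]; simp; omega
      simp [hv0 ▸ h0S, hv0]
    · by_cases hvS : v ∈ S
      · simp [hvS, hv0]
      · simp only [hvS, hv0, Finset.mem_singleton, if_false, sub_zero]
        rw [hmemS] at hvS
        refine hκ0 v (Nat.one_le_iff_ne_zero.2 fun h0 => hv0 ?_) (by omega)
        ext j
        simpa using (Finset.sum_eq_zero_iff.1 h0) j (Finset.mem_univ j)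
  set R : ℝ → Ω → ℝ := fun r ω => ∫ x in r • Δ, F (η x ω) with hR
  have hRL : ∀ r, MemLp (R r) 2 P := fun r => memLp_two_integral_comp hfm hlaw _ hF2
  have hproj0 : ∀ w, hermiteProj G {0} w = C₀ := fun w => by
    simp [hermiteProj, hermiteProd_zero, C₀]
  have hdecomp : ∀ r, K r =ᵐ[P] fun ω => I r ω + (R r ω + volume.real (r • Δ) * C₀) := by
    intro r
    filter_upwards [ae_integrable_comp hfm hlaw (volume.restrict (r • Δ)) hG,
      ae_integrable_comp hfm hlaw (volume.restrict (r • Δ)) (memLp_hermiteProj G S)] with ω h1 h2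
    have h3 : R r ω = (∫ x in r • Δ, G (η x ω)) - I r ω - volume.real (r • Δ) * C₀ := by
      simp only [hR, hF, hI, hproj0]
      have h12 : Integrable (fun x => G (η x ω) - hermiteProj G S (η x ω))
        (volume.restrict (r • Δ)) := h1.sub h2
      rw [integral_sub h12 (integrable_const _), integral_sub h1 h2]
      simp
    rw [h3]
    change (∫ x in r • Δ, G (η x ω)) = _
    ring
  have hIint : ∀ r, Integrable (I r) P := fun r => (hIL r).integrable (by norm_num)
  have hRint : ∀ r, Integrable (R r) P := fun r => (hRL r).integrable (by norm_num)
  have hImean : ∀ r, ∫ ω, I r ω ∂P = 0 := fun r => by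
    rw [hI]
    simp only
    rw [integral_integral_comp hfm hlaw _ (memLp_hermiteProj G S), integral_eq_hermiteCoeff_zero,
      hermiteCoeff_hermiteProj, if_neg (by rw [hmemS]; simp; omega), mul_zero]
  have hRmean : ∀ r, ∫ ω, R r ω ∂P = 0 := fun r => by
    rw [hR]
    simp only
    rw [integral_integral_comp hfm hlaw _ hF2, integral_eq_hermiteCoeff_zero, hFC 0 (by simp),
      mul_zero]
  have hKmean : ∀ r, ∫ ω, K r ω ∂P = volume.real (r • Δ) * C₀ := fun r => by
    have hRc : Integrable (fun ω => R r ω + volume.real (r • Δ) * C₀) P :=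
      (hRint r).add (integrable_const _)
    rw [integral_congr_ae (hdecomp r), integral_add (hIint r) hRc,
      integral_add (hRint r) (integrable_const _), hImean, hRmean]
    simp
  -- centred variables
  set X : ℝ → Ω → ℝ := fun r ω => K r ω - ∫ ω', K r ω' ∂P with hX
  have hXL : ∀ r, MemLp (X r) 2 P := fun r => (hKL r).sub (memLp_const _)
  have hXe : ∀ r, X r =ᵐ[P] fun ω => I r ω + R r ω := fun r => by
    filter_upwards [hdecomp r] with ω hω
    simp only [hX]
    rw [hω, hKmean]
    ring
  have hVarK : ∀ r, Var[K r; P] = ∫ ω, X r ω ^ 2 ∂P := fun r =>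
    variance_eq_integral (hKL r).aemeasurable
  have hKκmean : ∀ r, ∫ ω, Kκ r ω ∂P = 0 := fun r => by
    rw [integral_congr_ae (hKκI r), hImean]
  have hVarKκ : ∀ r, Var[Kκ r; P] = ∫ ω, Kκ r ω ^ 2 ∂P := fun r => by
    rw [variance_eq_integral (hKκL r).aemeasurable, hKκmean]
    simp
  have hKκsq : ∀ r, ∫ ω, Kκ r ω ^ 2 ∂P = ∫ ω, I r ω ^ 2 ∂P := fun r =>
    integral_congr_ae (by filter_upwards [hKκI r] with ω hω; rw [hω])
  have hXKκ : ∀ r, ∫ ω, (X r ω - Kκ r ω) ^ 2 ∂P = ∫ ω, R r ω ^ 2 ∂P := fun r =>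
    integral_congr_ae (by
      filter_upwards [hKκI r, hXe r] with ω h1 h2
      rw [h1, h2]; ring)
  have hVarsub : ∀ r, Var[K r - Kκ r; P] = ∫ ω, (X r ω - Kκ r ω) ^ 2 ∂P := fun r => by
    rw [variance_eq_integral ((hKL r).sub (hKκL r)).aemeasurable]
    have : P[K r - Kκ r] = ∫ ω, K r ω ∂P := by
      change ∫ ω, (K r ω - Kκ r ω) ∂P = _
      rw [integral_sub ((hKL r).integrable (by norm_num)) ((hKκL r).integrable (by norm_num)),
        hKκmean, sub_zero]
    rw [this]
    refine integral_congr_ae (ae_of_all _ fun ω => ?_)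
    simp only [Pi.sub_apply, hX]
    ring
  -- asymptotics of the variances
  obtain ⟨C, hC⟩ := hη.exists_integral_sq_le hd hΔ_convex hΔ_bounded hF2 hFC
    (hβ0.trans (hb₁.trans hb₂).le) hb₂d hb₂α
  obtain ⟨c, hc0, hc⟩ := hη.exists_le_integral_sq_hermiteProd hΔ_convex hΔ_bounded hΔ_zero v₀ hb₁
    (hb₂.trans hb₂d)
  set q : ℝ := (hermiteCoeff G v₀ / (∏ j, (v₀ j).factorial : ℕ)) ^ 2 * c with hq
  have hq0 : 0 < q := mul_pos (by
    have := div_ne_zero hv₀C (prod_factorial_pos v₀).ne'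
    positivity) hc0
  have hlow : ∀ᶠ r : ℝ in atTop, 0 < r ∧
      q * (r ^ (d : ℝ) * r ^ ((d : ℝ) - b₁)) ≤ ∫ ω, Kκ r ω ^ 2 ∂P := by
    filter_upwards [hc, eventually_gt_atTop 0] with r hr hr0
    refine ⟨hr0, ?_⟩
    rw [hKκsq, hq, mul_assoc]
    exact (mul_le_mul_of_nonneg_left hr (sq_nonneg _)).trans
      (hη.le_integral_sq_hermiteProj G ((hmemS v₀).2 hv₀κ) _)
  have hpos : ∀ᶠ r in atTop, 0 < ∫ ω, Kκ r ω ^ 2 ∂P := by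
    filter_upwards [hlow] with r hr
    have := hr.1
    exact lt_of_lt_of_le (by positivity) hr.2
  have hlim : Tendsto (fun r => (∫ ω, (X r ω - Kκ r ω) ^ 2 ∂P) / ∫ ω, Kκ r ω ^ 2 ∂P)
      atTop (𝓝 0) := by
    have h1 : Tendsto (fun r : ℝ => C / q * r ^ (-(b₂ - b₁))) atTop (𝓝 0) := by
      simpa using (tendsto_rpow_neg_atTop (sub_pos.2 hb₂)).const_mul (C / q)
    refine squeeze_zero' (Eventually.of_forall fun r => ?_) ?_ h1
    · exact div_nonneg (integral_nonneg fun _ => sq_nonneg _) (integral_nonneg fun _ => sq_nonneg _)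
    · filter_upwards [hlow] with r hr
      obtain ⟨hr0, hr⟩ := hr
      have hden : 0 < q * (r ^ (d : ℝ) * r ^ ((d : ℝ) - b₁)) := by positivity
      rw [hXKκ]
      refine (div_le_div_of_nonneg_left (integral_nonneg fun _ => sq_nonneg _) hden hr).trans ?_
      rw [div_le_iff₀ hden]
      refine (hC r hr0).trans_eq ?_
      have : r ^ ((d : ℝ) - b₂) = r ^ (-(b₂ - b₁)) * r ^ ((d : ℝ) - b₁) := by
        rw [← Real.rpow_add hr0]; congr 1; ring
      rw [this]
      field_simp
  obtain ⟨hposX, hmeas⟩ := tendstoInMeasure_normalized_sub hXL hKκL hpos hlim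
  refine ⟨fun r => ae_integrable_comp hfm hlaw _ hG,
    fun r v => ae_integrable_comp hfm hlaw _ (memLp_hermiteProd v),
    fun r => ⟨hKL r, hKκL r⟩, ?_, ?_, ?_⟩
  · filter_upwards [hpos, hposX] with r h1 h2
    rw [hVarK, hVarKκ]
    exact ⟨h2, h1⟩
  · simp_rw [hVarsub, hVarKκ]
    exact hlim
  · intro ν _
    simp_rw [hVarK, hVarKκ]
    have hXm : ∀ r, AEMeasurable (fun ω => X r ω / √(∫ ω, X r ω ^ 2 ∂P)) P := fun r =>
      (hXL r).aemeasurable.div_const _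
    have hYm : ∀ r, AEMeasurable (fun ω => Kκ r ω / √(∫ ω, Kκ r ω ^ 2 ∂P)) P := fun r =>
      (hKκL r).aemeasurable.div_const _
    constructor
    · intro h
      -- Slutsky's theorem; here the difference appears with the opposite sign, which its norm does
      -- not see.
      refine tendstoInDistribution_of_tendstoInMeasure_sub _ _ h ?_ hYm
      intro ε hε
      refine (hmeas ε hε).congr fun r => ?_
      congr with ω
      simp only [Pi.sub_apply, Pi.zero_apply, edist_eq_enorm_sub, sub_zero]
      rw [← enorm_neg, neg_sub]
    · intro h
      exact tendstoInDistribution_of_tendstoInMeasure_sub _ _ h hmeas hXm
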